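/- Let $n\in\mathbb{N}$, let $A_n^+=\mathbb{C}[t_1,\dots,t_n]$, let $W_n^+=\mathrm{Der}_{\mathbb C}(A_n^+)=\bigoplus_{i=1}^n A_n^+\partial_i$ with $\partial_i=\partial/\partial t_i$, and put $d_i=t_i\partial_i$. Let $W_n^+\ltimes A_n^+$ be the semidirect product Lie algebra with $A_n^+$ abelian and $[D,f]=D(f)$ for $D\in W_n^+$, $f\in A_n^+$. An $AW_n^+$ module is a module $V$ over this Lie algebra on which $A_n^+$ acts associatively: $f(gv)=(fg)v$ and $1v=v$ for all $f,g\in A_n^+$, $v\in V$. Let $K_n^+=\mathbb{C}[t_1,\dots,t_n,\partial_1,\dots,\partial_n]$ be the Weyl algebra. A module $V$ over $W_n^+\ltimes A_n^+$ or over $K_n^+$ is a weight module if $V=\bigoplus_{\alpha\in\mathbb{C}^n}V_\alpha$, where $V_\alpha=\{v\in V: d_iv=\alpha_iv \text{ for all } i\}$; a weight module is bounded if there is an integer $N$ with $\dim V_\alpha\le N$ for all $\alpha$. For a $K_n^+$ module $P$ and a $\mathfrak{gl}_n(\mathbb{C})$ module $M$, let $F(P,M)=P\otimes_{\mathbb C}M$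 be the $AW_n^+$ module with $$t^\alpha\partial_j\cdot(g\otimes v)=(t^\alpha\partial_j g)\otimes v+\sum_{i=1}^n(\partial_i(t^\alpha)g)\otimes(E_{ij}v),\qquad t^\alpha\cdot(g\otimes v)=(t^\alpha g)\otimes v$$ for $\alpha\in\mathbb{Z}_{\ge 0}^n$, $1\le j\le n$, $g\in P$, $v\in M$, where $E_{ij}$ are the matrix units. **Theorem.** Let $V$ be a simple bounded weight $AW_n^+$ module. Then there exist a simple weight $K_n^+$ module $P$ and a simple finite-dimensional $\mathfrak{gl}_n(\mathbb{C})$ module $M$ such that $V\cong F(P,M)$ as $AW_n^+$ modules. -/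

import Mathlib

open scoped TensorProduct

universe u

attribute [local instance 100] LieRing.ofAssociativeRing

noncomputable section

/-! ### The Lie algebras -/

/-- The polynomial algebra `A_n^+ = ℂ[t_1, …, t_n]`. It is also regarded as a Lie algebra through its
commutator, which vanishes. -/
abbrev PolyAlg (n : ℕ) : Type := MvPolynomial (Fin n) ℂ

/-- The Witt algebra `W_n^+` of all derivations of `ℂ[t_1, …, t_n]`, with the commutator bracket. -/
abbrev WittPlus (n : ℕ) : Type := Derivation ℂ (PolyAlg n) (PolyAlg n)

/-- The natural action of `W_n^+` on the abelian Lie algebra `A_n^+`. -/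
def wittAction (n : ℕ) : WittPlus n →ₗ⁅ℂ⁆ LieDerivation ℂ (PolyAlg n) (PolyAlg n) where
  toFun D :=
    { toLinearMap := D.toLinearMap
      leibniz' := fun a b => by simp [LieRing.of_associative_ring_bracket, mul_comm] }
  map_add' D E := by ext; rfl
  map_smul' c D := by ext; rfl
  map_lie' {D E} := by
    apply LieDerivation.ext
    intro a
    rw [LieDerivation.commutator_apply]
    exact Derivation.commutator_apply (D1 := D) (D2 := E) a

/-- The semidirect product `W_n^+ ⋉ A_n^+`, in which `[D, f] = D f` for `D ∈ W_n^+`, `f ∈ A_n^+`. -/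
abbrev ExtWitt (n : ℕ) : Type := LieAlgebra.SemiDirectSum (PolyAlg n) (WittPlus n) (wittAction n)

/-- A polynomial, as an element of `W_n^+ ⋉ A_n^+`. -/
abbrev polyElt {n : ℕ} (f : PolyAlg n) : ExtWitt n := LieAlgebra.SemiDirectSum.inl (wittAction n) f

/-- A vector field, as an element of `W_n^+ ⋉ A_n^+`. -/
abbrev wittElt {n : ℕ} (D : WittPlus n) : ExtWitt n := LieAlgebra.SemiDirectSum.inr (wittAction n) D

/-- The Euler field `d_i = t_i ∂_i`. -/
def eulerField {n : ℕ} (i : Fin n) : WittPlus n :=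
  (MvPolynomial.X i : PolyAlg n) • MvPolynomial.pderiv i

/-- The general linear Lie algebra `𝔤𝔩_n(ℂ)`. -/
abbrev GL_Lie (n : ℕ) : Type := Matrix (Fin n) (Fin n) ℂ

/-! ### Weight spaces -/

section Weight

variable {n : ℕ} {V : Type*} [AddCommGroup V] [Module ℂ V]

/-- The weight space `V_α = {v | d_i v = α_i v for all i}` of a family of operators `d_1, …, d_n`. -/
def weightSpace (d : Fin n → Module.End ℂ V) (α : Fin n → ℂ) : Submodule ℂ V where
  carrier := {v | ∀ i, d i v = α i • v}
  add_mem' {v w} hv hw i := by rw [map_add, hv i, hw i, smul_add]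
  zero_mem' i := by simp
  smul_mem' c v hv i := by rw [map_smul, hv i, smul_comm]

/-- `V` is the internal direct sum of the weight spaces. -/
def IsWeight (d : Fin n → Module.End ℂ V) : Prop :=
  iSupIndep (weightSpace d) ∧ ⨆ α, weightSpace d α = ⊤

/-- The dimensions of the weight spaces are uniformly bounded by a natural number. -/
def HasBoundedWeightSpaces (d : Fin n → Module.End ℂ V) : Prop :=
  ∃ N : ℕ, ∀ α, Module.rank ℂ (weightSpace d α) ≤ (N : Cardinal)

end Weight

/-! ### `AW_n^+` modules -/

section AW

variable (n : ℕ) (V : Type*) [AddCommGroup V] [Module ℂ V] [LieRingModule (ExtWitt n) V]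

/-- A module over `W_n^+ ⋉ A_n^+` is an `AW_n^+` module if `A_n^+` acts associatively and unitally. -/
structure IsAWModule : Prop where
  mul_lie : ∀ (f g : PolyAlg n) (v : V), ⁅polyElt f, ⁅polyElt g, v⁆⁆ = ⁅polyElt (f * g), v⁆
  one_lie : ∀ v : V, ⁅polyElt (1 : PolyAlg n), v⁆ = v

/-- The operators by which `d_1, …, d_n` act on a module over `W_n^+ ⋉ A_n^+`. -/
def eulerOp [LieModule ℂ (ExtWitt n) V] (i : Fin n) : Module.End ℂ V :=
  LieModule.toEnd ℂ (ExtWitt n) V (wittElt (eulerField i))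

end AW

/-! ### The Weyl algebra -/

/-- The defining relations of the Weyl algebra; the generator `Sum.inl i` stands for `t_i`,
the generator `Sum.inr i` for `∂_i`. -/
inductive WeylRel (n : ℕ) :
    FreeAlgebra ℂ (Fin n ⊕ Fin n) → FreeAlgebra ℂ (Fin n ⊕ Fin n) → Prop
  | t_comm (i j : Fin n) : WeylRel n
      (FreeAlgebra.ι ℂ (Sum.inl i) * FreeAlgebra.ι ℂ (Sum.inl j))
      (FreeAlgebra.ι ℂ (Sum.inl j) * FreeAlgebra.ι ℂ (Sum.inl i))
  | d_comm (i j : Fin n) : WeylRel n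
      (FreeAlgebra.ι ℂ (Sum.inr i) * FreeAlgebra.ι ℂ (Sum.inr j))
      (FreeAlgebra.ι ℂ (Sum.inr j) * FreeAlgebra.ι ℂ (Sum.inr i))
  | d_t (i j : Fin n) : WeylRel n
      (FreeAlgebra.ι ℂ (Sum.inr i) * FreeAlgebra.ι ℂ (Sum.inl j))
      (FreeAlgebra.ι ℂ (Sum.inl j) * FreeAlgebra.ι ℂ (Sum.inr i) + if i = j then 1 else 0)

/-- The Weyl algebra `K_n^+ = ℂ[t_1, …, t_n, ∂_1, …, ∂_n]`. -/
def WeylAlg (n : ℕ) : Type := RingQuot (WeylRel n)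

namespace WeylAlg

variable {n : ℕ}

instance : Ring (WeylAlg n) := inferInstanceAs (Ring (RingQuot (WeylRel n)))

instance : Algebra ℂ (WeylAlg n) := inferInstanceAs (Algebra ℂ (RingQuot (WeylRel n)))

/-- The generator `t_i`. -/
def t (i : Fin n) : WeylAlg n :=
  RingQuot.mkAlgHom ℂ (WeylRel n) (FreeAlgebra.ι ℂ (Sum.inl i))

/-- The generator `∂_i`. -/
def d (i : Fin n) : WeylAlg n :=
  RingQuot.mkAlgHom ℂ (WeylRel n) (FreeAlgebra.ι ℂ (Sum.inr i))

theorem t_mul_t (i j : Fin n) : (t i * t j : WeylAlg n) = t j * t i := by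
  have h := RingQuot.mkAlgHom_rel ℂ (WeylRel.t_comm i j)
  rw [map_mul, map_mul] at h
  exact h

theorem d_mul_d (i j : Fin n) : (d i * d j : WeylAlg n) = d j * d i := by
  have h := RingQuot.mkAlgHom_rel ℂ (WeylRel.d_comm i j)
  rw [map_mul, map_mul] at h
  exact h

theorem d_mul_t (i j : Fin n) :
    (d i * t j : WeylAlg n) = t j * d i + if i = j then 1 else 0 := by
  have h := RingQuot.mkAlgHom_rel ℂ (WeylRel.d_t i j)
  rw [map_add, map_mul, map_mul, apply_ite (RingQuot.mkAlgHom ℂ (WeylRel n)), map_one,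
    map_zero] at h
  exact h

open scoped IsMulCommutative in
/-- The inclusion `ℂ[t_1, …, t_n] → K_n^+` sending the variable `t_i` to the generator `t_i`.
It is evaluation at the generators, inside the commutative subalgebra that they generate. -/
def ofPoly : PolyAlg n →ₐ[ℂ] WeylAlg n :=
  haveI := Algebra.isMulCommutative_adjoin ℂ (s := Set.range (t : Fin n → WeylAlg n))
    (by rintro _ ⟨i, rfl⟩ _ ⟨j, rfl⟩; exact t_mul_t i j)
  (Algebra.adjoin ℂ (Set.range (t : Fin n → WeylAlg n))).val.comp
    (MvPolynomial.aeval fun i => ⟨t i, Algebra.subset_adjoin (Set.mem_range_self i)⟩)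

@[simp] theorem ofPoly_X (i : Fin n) : ofPoly (MvPolynomial.X i : PolyAlg n) = t i := by
  simp [ofPoly]

theorem d_mul_ofPoly (i : Fin n) (f : PolyAlg n) :
    d i * ofPoly f = ofPoly f * d i + ofPoly (MvPolynomial.pderiv i f) := by
  induction f using MvPolynomial.induction_on with
  | C a =>
    have h : ofPoly (MvPolynomial.C a : PolyAlg n) = algebraMap ℂ (WeylAlg n) a :=
      ofPoly.commutes a
    rw [h, MvPolynomial.pderiv_C, map_zero, add_zero]
    exact (Algebra.commutes a (d i)).symm
  | add p q hp hq => simp only [map_add, mul_add, add_mul, hp, hq]; abel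
  | mul_X p j hp =>
    have hX : d i * ofPoly (MvPolynomial.X j : PolyAlg n) =
        ofPoly (MvPolynomial.X j : PolyAlg n) * d i +
          ofPoly (MvPolynomial.pderiv i (MvPolynomial.X j : PolyAlg n)) := by
      rw [ofPoly_X, d_mul_t, MvPolynomial.pderiv_X, Pi.single_apply]
      simp only [eq_comm (a := i), apply_ite (ofPoly (n := n)), map_one, map_zero]
    rw [map_mul, ← mul_assoc, hp, add_mul, mul_assoc, hX, Derivation.leibniz, map_add,
      smul_eq_mul, smul_eq_mul, map_mul, mul_comm (MvPolynomial.X j : PolyAlg n), map_mul,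
      mul_add, mul_assoc, add_assoc]

/-- The element `∑ f_j ∂_j` of `K_n^+` given by the vector field `D = ∑ f_j ∂_j`; here
`f_j = D t_j`. -/
def ofWitt : WittPlus n →ₗ[ℂ] WeylAlg n where
  toFun D := ∑ j, ofPoly (D (MvPolynomial.X j)) * d j
  map_add' D E := by simp [add_mul, Finset.sum_add_distrib]
  map_smul' c D := by simp [Finset.smul_sum]

theorem derivation_sum_apply (F : Fin n → WittPlus n) (f : PolyAlg n) :
    (∑ j, F j) f = ∑ j, F j f := by
  rw [← Derivation.coeFnAddMonoidHom_apply, map_sum, Finset.sum_apply]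
  rfl

theorem ofWitt_mul_ofPoly (D : WittPlus n) (f : PolyAlg n) :
    ofWitt D * ofPoly f = ofPoly f * ofWitt D + ofPoly (D f) := by
  have hD : D f = ∑ j, D (MvPolynomial.X j) * MvPolynomial.pderiv j f := by
    have h : D = ∑ j, D (MvPolynomial.X j) • (MvPolynomial.pderiv j : WittPlus n) := by
      apply MvPolynomial.derivation_ext
      intro i
      rw [derivation_sum_apply]
      simp [MvPolynomial.pderiv_X, Pi.single_apply]
    conv_lhs => rw [h]
    rw [derivation_sum_apply]
    simp
  rw [hD, map_sum]
  simp only [ofWitt, LinearMap.coe_mk, AddHom.coe_mk, Finset.sum_mul, Finset.mul_sum,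
    ← Finset.sum_add_distrib]
  refine Finset.sum_congr rfl fun j _ => ?_
  rw [mul_assoc, d_mul_ofPoly, mul_add, ← mul_assoc, ← mul_assoc, ← map_mul, ← map_mul,
    ← map_mul, mul_comm f]

theorem ofWitt_lie (D E : WittPlus n) :
    ofWitt ⁅D, E⁆ = ofWitt D * ofWitt E - ofWitt E * ofWitt D := by
  have key : ∀ D E : WittPlus n, ofWitt D * ofWitt E =
      ∑ j, ∑ k, ofPoly (E (MvPolynomial.X j) * D (MvPolynomial.X k)) * (d k * d j) +
        ∑ j, ofPoly (D (E (MvPolynomial.X j))) * d j := by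
    intro D E
    have h : ofWitt E = ∑ j, ofPoly (E (MvPolynomial.X j)) * d j := rfl
    have h' : ofWitt D = ∑ j, ofPoly (D (MvPolynomial.X j)) * d j := rfl
    rw [h, Finset.mul_sum, ← Finset.sum_add_distrib]
    refine Finset.sum_congr rfl fun j _ => ?_
    rw [← mul_assoc, ofWitt_mul_ofPoly, add_mul, h', Finset.mul_sum, Finset.sum_mul]
    simp only [map_mul, mul_assoc]
  have hs : ∑ j, ∑ k, ofPoly (E (MvPolynomial.X j) * D (MvPolynomial.X k)) * (d k * d j) =
      ∑ j, ∑ k, ofPoly (D (MvPolynomial.X j) * E (MvPolynomial.X k)) * (d k * d j) := by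
    rw [Finset.sum_comm]
    refine Finset.sum_congr rfl fun j _ => Finset.sum_congr rfl fun k _ => ?_
    rw [mul_comm (E _), d_mul_d]
  have h : ofWitt ⁅D, E⁆ = ∑ j, ofPoly (⁅D, E⁆ (MvPolynomial.X j)) * d j := rfl
  rw [key, key, hs, add_sub_add_left_eq_sub, ← Finset.sum_sub_distrib, h]
  refine Finset.sum_congr rfl fun j _ => ?_
  rw [Derivation.commutator_apply, map_sub, sub_mul]

end WeylAlg

/-- The operators by which `d_i = t_i ∂_i` acts on a module over the Weyl algebra. -/
def weylEulerOp (n : ℕ) (P : Type*) [AddCommGroup P] [Module ℂ P] [Module (WeylAlg n) P]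
    [IsScalarTower ℂ (WeylAlg n) P] (i : Fin n) : Module.End ℂ P :=
  Algebra.lsmul ℂ ℂ P (WeylAlg.t i * WeylAlg.d i)

/-! ### The tensor modules `F(P, M)` -/

section Tensor

set_option linter.unusedSectionVars false

variable (n : ℕ) (P : Type*) [AddCommGroup P] [Module ℂ P] [Module (WeylAlg n) P]
  [IsScalarTower ℂ (WeylAlg n) P]
  (M : Type*) [AddCommGroup M] [Module ℂ M] [LieRingModule (GL_Lie n) M]
  [LieModule ℂ (GL_Lie n) M]

/-- The action of the Weyl algebra on the first factor of `P ⊗ M`. -/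
def weylOp : WeylAlg n →ₐ[ℂ] Module.End ℂ (P ⊗[ℂ] M) :=
  (Module.End.rTensorAlgHom ℂ P M).comp (Algebra.lsmul ℂ ℂ P)

/-- The action of `𝔤𝔩_n` on the second factor of `P ⊗ M`. -/
def glOp (X : GL_Lie n) : Module.End ℂ (P ⊗[ℂ] M) :=
  LinearMap.lTensor P (LieModule.toEnd ℂ (GL_Lie n) M X)

/-- The operator by which the vector field `D = ∑ f_j ∂_j` acts on `F(P, M)`:
`D (g ⊗ v) = (D g) ⊗ v + ∑_{i, j} (∂_i(f_j) g) ⊗ (E_{ij} v)`, where `f_j = D t_j`. -/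
def wittOp (D : WittPlus n) : Module.End ℂ (P ⊗[ℂ] M) :=
  weylOp n P M (WeylAlg.ofWitt D) +
    ∑ i, ∑ j, weylOp n P M
      (WeylAlg.ofPoly (MvPolynomial.pderiv i (D (MvPolynomial.X j)))) *
        glOp n P M (Matrix.single i j 1)

theorem weylOp_tmul (x : WeylAlg n) (g : P) (v : M) :
    weylOp n P M x (g ⊗ₜ v) = (x • g) ⊗ₜ v := rfl

theorem glOp_tmul (X : GL_Lie n) (g : P) (v : M) :
    glOp n P M X (g ⊗ₜ v) = g ⊗ₜ ⁅X, v⁆ := rfl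

theorem glOp_mul_weylOp (X : GL_Lie n) (x : WeylAlg n) :
    glOp n P M X * weylOp n P M x = weylOp n P M x * glOp n P M X := by
  apply TensorProduct.ext'
  intro g v
  simp only [Module.End.mul_apply, weylOp_tmul, glOp_tmul]

theorem glOp_lie (X Y : GL_Lie n) :
    glOp n P M X * glOp n P M Y - glOp n P M Y * glOp n P M X = glOp n P M (X * Y - Y * X) := by
  apply TensorProduct.ext'
  intro g v
  simp only [LinearMap.sub_apply, Module.End.mul_apply, glOp_tmul]
  rw [← LieRing.of_associative_ring_bracket, lie_lie, TensorProduct.tmul_sub]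

/-- The operator `∑_{i, j} B_{ij} ⊗ E_{ij}` on `P ⊗ M`. -/
def matOp (B : Matrix (Fin n) (Fin n) (PolyAlg n)) : Module.End ℂ (P ⊗[ℂ] M) :=
  ∑ i, ∑ j, weylOp n P M (WeylAlg.ofPoly (B i j)) * glOp n P M (Matrix.single i j 1)

theorem matOp_sub (B C : Matrix (Fin n) (Fin n) (PolyAlg n)) :
    matOp n P M (B - C) = matOp n P M B - matOp n P M C := by
  simp only [matOp, Matrix.sub_apply, map_sub, sub_mul, Finset.sum_sub_distrib]

theorem matOp_add (B C : Matrix (Fin n) (Fin n) (PolyAlg n)) :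
    matOp n P M (B + C) = matOp n P M B + matOp n P M C := by
  simp only [matOp, Matrix.add_apply, map_add, add_mul, Finset.sum_add_distrib]

theorem glOp_single_lie (i j k l : Fin n) :
    glOp n P M (Matrix.single i j 1) * glOp n P M (Matrix.single k l 1) -
      glOp n P M (Matrix.single k l 1) * glOp n P M (Matrix.single i j 1) =
      (if j = k then glOp n P M (Matrix.single i l 1) else 0) -
        (if l = i then glOp n P M (Matrix.single k j 1) else 0) := by
  have hz : glOp n P M 0 = 0 := by simp [glOp]
  have hs : ∀ X Y : GL_Lie n, glOp n P M (X - Y) = glOp n P M X - glOp n P M Y := by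
    intro X Y
    simp only [glOp, map_sub, LinearMap.lTensor_sub]
  have hm : ∀ i j k l : Fin n,
      glOp n P M (Matrix.single i j 1 * Matrix.single k l 1) =
        if j = k then glOp n P M (Matrix.single i l 1) else 0 := by
    intro i j k l
    split_ifs with h
    · subst h
      rw [Matrix.single_mul_single_same, one_mul]
    · rw [Matrix.single_mul_single_of_ne _ _ _ _ h, hz]
  rw [glOp_lie, hs, hm, hm]

theorem matOp_lie (B C : Matrix (Fin n) (Fin n) (PolyAlg n)) :
    matOp n P M B * matOp n P M C - matOp n P M C * matOp n P M B =
      matOp n P M (B * C - C * B) := by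
  have hmul : ∀ B C : Matrix (Fin n) (Fin n) (PolyAlg n),
      matOp n P M B * matOp n P M C = ∑ i, ∑ j, ∑ k, ∑ l,
        weylOp n P M (WeylAlg.ofPoly (B i j * C k l)) *
          (glOp n P M (Matrix.single i j 1) * glOp n P M (Matrix.single k l 1)) := by
    intro B C
    simp only [matOp, Finset.sum_mul]
    refine Finset.sum_congr rfl fun i _ => Finset.sum_congr rfl fun j _ => ?_
    simp only [Finset.mul_sum]
    refine Finset.sum_congr rfl fun k _ => Finset.sum_congr rfl fun l _ => ?_
    rw [mul_assoc, ← mul_assoc (glOp n P M _), glOp_mul_weylOp, map_mul, map_mul]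
    simp only [mul_assoc]
  have hprod : ∀ B C : Matrix (Fin n) (Fin n) (PolyAlg n),
      matOp n P M (B * C) = ∑ i, ∑ j, ∑ k, ∑ l,
        weylOp n P M (WeylAlg.ofPoly (B i j * C k l)) *
          (if j = k then glOp n P M (Matrix.single i l 1) else 0) := by
    intro B C
    simp only [matOp, Matrix.mul_apply, map_sum, Finset.sum_mul, mul_ite, mul_zero]
    refine Finset.sum_congr rfl fun i _ => ?_
    rw [Finset.sum_comm]
    refine Finset.sum_congr rfl fun j _ => ?_
    rw [Finset.sum_comm]
    refine Finset.sum_congr rfl fun l _ => ?_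
    simp
  have hswap : ∀ F : Fin n → Fin n → Fin n → Fin n → Module.End ℂ (P ⊗[ℂ] M),
      ∑ i, ∑ j, ∑ k, ∑ l, F i j k l = ∑ i, ∑ j, ∑ k, ∑ l, F k l i j := by
    intro F
    have h : ∀ i, ∑ j, ∑ k, ∑ l, F i j k l = ∑ k, ∑ l, ∑ j, F i j k l := by
      intro i
      rw [Finset.sum_comm]
      exact Finset.sum_congr rfl fun k _ => Finset.sum_comm
    simp only [h]
    rw [Finset.sum_comm]
    refine Finset.sum_congr rfl fun i _ => ?_
    rw [Finset.sum_comm]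
  rw [matOp_sub, hmul B C, hmul C B, hswap (fun i j k l =>
    weylOp n P M (WeylAlg.ofPoly (C i j * B k l)) *
      (glOp n P M (Matrix.single i j 1) * glOp n P M (Matrix.single k l 1))), hprod B C,
    hprod C B, hswap (fun i j k l => weylOp n P M (WeylAlg.ofPoly (C i j * B k l)) *
      (if j = k then glOp n P M (Matrix.single i l 1) else 0))]
  simp only [← Finset.sum_sub_distrib]
  refine Finset.sum_congr rfl fun i _ => Finset.sum_congr rfl fun j _ =>
    Finset.sum_congr rfl fun k _ => Finset.sum_congr rfl fun l _ => ?_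
  rw [mul_comm (C k l), ← mul_sub, ← mul_sub, glOp_single_lie]

theorem weylOp_matOp (D : WittPlus n) (B : Matrix (Fin n) (Fin n) (PolyAlg n)) :
    weylOp n P M (WeylAlg.ofWitt D) * matOp n P M B -
      matOp n P M B * weylOp n P M (WeylAlg.ofWitt D) =
      matOp n P M (B.map D) := by
  simp only [matOp, Finset.mul_sum, Finset.sum_mul, ← Finset.sum_sub_distrib]
  refine Finset.sum_congr rfl fun i _ => Finset.sum_congr rfl fun j _ => ?_
  rw [mul_assoc, glOp_mul_weylOp, ← mul_assoc, ← mul_assoc, ← sub_mul, ← map_mul, ← map_mul,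
    ← map_sub, WeylAlg.ofWitt_mul_ofPoly, add_sub_cancel_left, Matrix.map_apply]

/-- The matrix with entries `∂_i(f_j)`, for `D = ∑ f_j ∂_j`. -/
def jac {n : ℕ} (D : WittPlus n) : Matrix (Fin n) (Fin n) (PolyAlg n) :=
  Matrix.of fun i j => MvPolynomial.pderiv i (D (MvPolynomial.X j))

theorem jac_lie (D E : WittPlus n) :
    jac ⁅D, E⁆ = (jac E).map D - (jac D).map E + (jac D * jac E - jac E * jac D) := by
  have key : ∀ (D : WittPlus n) (i : Fin n) (f : PolyAlg n), MvPolynomial.pderiv i (D f) =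
      D (MvPolynomial.pderiv i f) + ∑ k, jac D i k * MvPolynomial.pderiv k f := by
    intro D i f
    have h : ⁅(MvPolynomial.pderiv i : WittPlus n), D⁆ =
        ∑ k, jac D i k • (MvPolynomial.pderiv k : WittPlus n) := by
      apply MvPolynomial.derivation_ext
      intro j
      rw [WeylAlg.derivation_sum_apply, Derivation.commutator_apply]
      simp [jac, MvPolynomial.pderiv_X, Pi.single_apply, apply_ite D]
    have h' := congrArg (fun F : WittPlus n => F f) h
    simp only [Derivation.commutator_apply, WeylAlg.derivation_sum_apply, Derivation.smul_apply,
      smul_eq_mul] at h'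
    rw [← h']
    ring
  ext1 i j
  simp only [Matrix.add_apply, Matrix.sub_apply, Matrix.map_apply, Matrix.mul_apply]
  have h1 : jac ⁅D, E⁆ i j = MvPolynomial.pderiv i (D (E (MvPolynomial.X j))) -
      MvPolynomial.pderiv i (E (D (MvPolynomial.X j))) := by
    rw [← map_sub, ← Derivation.commutator_apply]
    rfl
  rw [h1, key D i (E (MvPolynomial.X j)), key E i (D (MvPolynomial.X j))]
  simp only [jac, Matrix.of_apply]
  ring

theorem wittOp_eq (D : WittPlus n) :
    wittOp n P M D = weylOp n P M (WeylAlg.ofWitt D) + matOp n P M (jac D) := rfl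

theorem wittOp_lie (D E : WittPlus n) :
    wittOp n P M ⁅D, E⁆ = wittOp n P M D * wittOp n P M E - wittOp n P M E * wittOp n P M D := by
  simp only [wittOp_eq]
  rw [jac_lie, matOp_add, matOp_sub, ← matOp_lie, ← weylOp_matOp, ← weylOp_matOp,
    WeylAlg.ofWitt_lie, map_sub, map_mul, map_mul]
  noncomm_ring

theorem wittOp_ofPoly (D : WittPlus n) (f : PolyAlg n) :
    wittOp n P M D * weylOp n P M (WeylAlg.ofPoly f) -
      weylOp n P M (WeylAlg.ofPoly f) * wittOp n P M D = weylOp n P M (WeylAlg.ofPoly (D f)) := by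
  have h : matOp n P M (jac D) * weylOp n P M (WeylAlg.ofPoly f) =
      weylOp n P M (WeylAlg.ofPoly f) * matOp n P M (jac D) := by
    simp only [matOp, Finset.mul_sum, Finset.sum_mul]
    refine Finset.sum_congr rfl fun i _ => Finset.sum_congr rfl fun j _ => ?_
    rw [mul_assoc, glOp_mul_weylOp, ← mul_assoc, ← mul_assoc, ← map_mul, ← map_mul, ← map_mul,
      ← map_mul, mul_comm]
  rw [wittOp_eq, add_mul, mul_add, h, ← map_mul, WeylAlg.ofWitt_mul_ofPoly, map_add, map_mul]
  abel

/-- The representation of `W_n^+ ⋉ A_n^+` on `P ⊗ M`: polynomials act on the first factor, and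
vector fields act by `wittOp`. -/
def tensorRep : ExtWitt n →ₗ⁅ℂ⁆ Module.End ℂ (P ⊗[ℂ] M) where
  toFun x := weylOp n P M (WeylAlg.ofPoly x.left) + wittOp n P M x.right
  map_add' x y := by
    have h : jac (x.right + y.right) = jac x.right + jac y.right := by
      ext1 i j
      simp [jac]
    simp only [LieAlgebra.SemiDirectSum.add_eq_mk, wittOp_eq, h, matOp_add, map_add]
    abel
  map_smul' c x := by
    have h : matOp n P M (jac (c • x.right)) = c • matOp n P M (jac x.right) := by
      simp [matOp, jac, Finset.smul_sum]
    simp only [LieAlgebra.SemiDirectSum.smul_eq_mk, wittOp_eq, h, map_smul, smul_add,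
      RingHom.id_apply]
  map_lie' {x y} := by
    have hc : weylOp n P M (WeylAlg.ofPoly x.left) * weylOp n P M (WeylAlg.ofPoly y.left) =
        weylOp n P M (WeylAlg.ofPoly y.left) * weylOp n P M (WeylAlg.ofPoly x.left) := by
      rw [← map_mul, ← map_mul, mul_comm, map_mul, map_mul]
    have hb : ⁅x.left, y.left⁆ = 0 := by
      rw [LieRing.of_associative_ring_bracket, mul_comm, sub_self]
    have hx : wittAction n x.right y.left = x.right y.left := rfl
    have hy : wittAction n y.right x.left = y.right x.left := rfl
    simp only [LieAlgebra.SemiDirectSum.lie_eq_mk]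
    rw [hb, hx, hy, zero_add, map_sub, map_sub, ← wittOp_ofPoly, ← wittOp_ofPoly, wittOp_lie,
      LieRing.of_associative_ring_bracket, add_mul, mul_add, mul_add, add_mul, mul_add, mul_add, hc]
    abel

/-- The tensor module `F(P, M) = P ⊗ M`. -/
def TensorModule : Type _ := P ⊗[ℂ] M

namespace TensorModule

instance : AddCommGroup (TensorModule P M) := inferInstanceAs (AddCommGroup (P ⊗[ℂ] M))

instance : Module ℂ (TensorModule P M) := inferInstanceAs (Module ℂ (P ⊗[ℂ] M))

/-- `x ∈ W_n^+ ⋉ A_n^+` acts on `F(P, M)` by `tensorRep n P M x`. -/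
instance : LieRingModule (ExtWitt n) (TensorModule P M) where
  bracket x u := (show P ⊗[ℂ] M from tensorRep n P M x (show P ⊗[ℂ] M from u))
  add_lie x y u := by
    change tensorRep n P M (x + y) _ = _
    rw [map_add]
    rfl
  lie_add x u v := map_add (tensorRep n P M x) _ _
  leibniz_lie x y u := by
    change tensorRep n P M x (tensorRep n P M y _) = tensorRep n P M ⁅x, y⁆ _ +
      tensorRep n P M y (tensorRep n P M x _)
    rw [LieHom.map_lie, LieRing.of_associative_ring_bracket, LinearMap.sub_apply]
    exact (sub_add_cancel _ _).symm

instance : LieModule ℂ (ExtWitt n) (TensorModule P M) where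
  smul_lie c x u := by
    change tensorRep n P M (c • x) _ = _
    rw [map_smul]
    rfl
  lie_smul c x u := map_smul (tensorRep n P M x) _ _

end TensorModule

end Tensor

end

/-!
Why the theorem is true. Let `K` be the Weyl algebra. An `AW_n^+` module `V` is a `K`-module, since
the polynomials and the constant vector fields satisfy the relations of `K` (`IsAWModule.weylRep`).
By Taylor expansion every vector field acts on `V` through `K` and operators commuting with `K`
(`apply_mem_of_commutant`). So a nonzero subspace of a simple `V` that is stable under `K` and its
commutant is all of `V`.

The operators `t_i ∂_i` of `K` commute with the `d_i`, hence act on the finite-dimensional weight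
spaces of `V` and have a common eigenvector there. Moving it by powers of the `t_i` and `∂_i` gives
a vector `v` which, for each `i`, is killed by `∂_i` or by `t_i` or has a non-integral eigenvalue
(`exists_isVacuum`). Then `P = K v` is a simple weight module with weight spaces of dimension at
most one (`isSimpleModule_span`), and evaluation `P ⊗ Hom_K(P, V) → V` is surjective by the first
paragraph and injective because of the one-dimensional weight spaces of `P`
(`evalTensor_injective`).

Put `M = Hom_K(P, V)`. The differences between the action of `t_i ∂_j` in `W_n^+` and in `K` commute
with `K` and make `V` and `M` modules over `𝔤𝔩_n` (`glEnd`, `glHom`). The weights of `M` lie in one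
coset of the integral weights, and the support of `P` contains an orthant, so finitely many weight
vectors of `M` all contribute to a single weight space of `V`; boundedness of `V` makes `M`
finite-dimensional (`finiteDimensional_hom`). Finally take an eigenvalue of the identity matrix
`1 ∈ 𝔤𝔩_n` on `M` with maximal real part. Vector fields with coefficients of degree at least two
would raise it, so on its eigenspace `V` looks like a tensor module; the eigenspace is therefore a
submodule, and equals `V` (`IsWeylCompatible.wittEnd_apply_eq`). A `𝔤𝔩_n` submodule `M'` of `M` now
yields the submodule `P ⊗ M'` of `V`, so `M` is simple.
-/

/-! ### Simultaneous eigenspaces -/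

section WeightSpaces

variable {n : ℕ} {V : Type*} [AddCommGroup V] [Module ℂ V] {d : Fin n → Module.End ℂ V}

theorem eq_of_mem_weightSpace {α β : Fin n → ℂ} {v : V} (hv : v ≠ 0)
    (h₁ : v ∈ weightSpace d α) (h₂ : v ∈ weightSpace d β) : α = β :=
  funext fun i => smul_left_injective ℂ hv ((h₁ i).symm.trans (h₂ i))

/-- The components of an element of an invariant subspace lie in that subspace: a component is
isolated by applying, for each other weight, an operator `d i - β i` which kills that weight. -/
theorem mem_of_add_sum_mem {ι : Type*} {N : Submodule ℂ V} (hN : ∀ i, ∀ v ∈ N, d i v ∈ N)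
    (ν : ι → Fin n → ℂ) (k₀ : ι) (s : Finset ι) :
    (∀ k ∈ s, ν k ≠ ν k₀) → ∀ x : ι → V, (∀ k, x k ∈ weightSpace d (ν k)) →
      x k₀ + ∑ k ∈ s, x k ∈ N → x k₀ ∈ N := by
  classical
  induction s using Finset.induction_on with
  | empty => intro _ x _ h; simpa using h
  | insert a s ha ih =>
    intro hs x hx h
    obtain ⟨i, hi⟩ := Function.ne_iff.1 (hs a (Finset.mem_insert_self a s))
    have h1 := N.sub_mem (hN i _ h) (N.smul_mem (ν a i) h)
    have h2 : d i (x k₀ + ∑ k ∈ insert a s, x k) - ν a i • (x k₀ + ∑ k ∈ insert a s, x k) =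
        (ν k₀ i - ν a i) • x k₀ + ∑ k ∈ s, (ν k i - ν a i) • x k := by
      rw [Finset.sum_insert ha]
      simp only [map_add, map_sum, smul_add, Finset.smul_sum, sub_smul, Finset.sum_sub_distrib]
      rw [hx k₀ i, hx a i, Finset.sum_congr rfl fun k _ => hx k i]
      abel
    rw [h2] at h1
    have h3 := ih (fun k hk => hs k (Finset.mem_insert_of_mem hk))
      (fun k => (ν k i - ν a i) • x k) (fun k => Submodule.smul_mem _ _ (hx k)) h1
    exact (N.smul_mem_iff (sub_ne_zero.2 hi.symm)).1 h3

theorem le_iSup_inf_of_invariant {ι : Type*} {N : Submodule ℂ V} (hN : ∀ i, ∀ v ∈ N, d i v ∈ N)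
    {ν : ι → Fin n → ℂ} (hν : Function.Injective ν) {U : ι → Submodule ℂ V}
    (hU : ∀ k, U k ≤ weightSpace d (ν k)) (hNU : N ≤ ⨆ k, U k) : N ≤ ⨆ k, U k ⊓ N := by
  classical
  intro x hx
  obtain ⟨f, hf, rfl⟩ := (Submodule.mem_iSup_iff_exists_finsupp U x).1 (hNU hx)
  refine Submodule.sum_mem _ fun k hk => Submodule.mem_iSup_of_mem k ⟨hf k, ?_⟩
  refine mem_of_add_sum_mem hN ν k (f.support.erase k)
    (fun j hj => fun h => (Finset.mem_erase.1 hj).1 (hν h)) f (fun k => hU k (hf k)) ?_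
  rw [Finset.add_sum_erase _ _ hk]
  exact hx

theorem iSupIndep_weightSpace (d : Fin n → Module.End ℂ V) : iSupIndep (weightSpace d) := by
  rw [iSupIndep_def]
  intro α
  rw [Submodule.disjoint_def]
  intro x hx hx'
  obtain ⟨f, hf, hfx⟩ := (Submodule.mem_iSup_iff_exists_finsupp _ x).1 hx'
  by_contra hne
  have hlin : ∀ i, ∀ v ∈ (ℂ ∙ x), d i v ∈ (ℂ ∙ x) := by
    intro i v hv
    obtain ⟨c, rfl⟩ := Submodule.mem_span_singleton.1 hv
    rw [map_smul, hx i]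
    exact Submodule.smul_mem _ _ (Submodule.smul_mem _ _ (Submodule.mem_span_singleton_self x))
  have hle : (ℂ ∙ x) ≤ ⨆ j : {j // j ≠ α}, weightSpace d j.1 := by
    rw [Submodule.span_singleton_le_iff_mem, iSup_subtype]
    exact hx'
  have h := le_iSup_inf_of_invariant hlin Subtype.val_injective (fun _ => le_rfl) hle
  have hbot : ⨆ j : {j // j ≠ α}, weightSpace d j.1 ⊓ (ℂ ∙ x) = ⊥ := by
    rw [iSup_eq_bot]
    intro j
    rw [eq_bot_iff]
    rintro v ⟨hv, hv'⟩
    by_contra hv0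
    obtain ⟨c, rfl⟩ := Submodule.mem_span_singleton.1 hv'
    exact j.2 (eq_of_mem_weightSpace hv0 hv (Submodule.smul_mem _ c hx))
  rw [hbot] at h
  exact hne ((Submodule.mem_bot ℂ).1 (h (Submodule.mem_span_singleton_self x)))

end WeightSpaces

/-! ### Modules over the Weyl algebra -/

namespace WeylAlg

variable {n : ℕ}

theorem adjoin_generators :
    Algebra.adjoin ℂ (Set.range (t : Fin n → WeylAlg n) ∪ Set.range d) = ⊤ := by
  rw [eq_top_iff]
  intro x _
  obtain ⟨y, rfl⟩ := RingQuot.mkAlgHom_surjective ℂ (WeylRel n) x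
  induction y using FreeAlgebra.induction with
  | grade0 r =>
    rw [AlgHom.commutes]
    exact Subalgebra.algebraMap_mem _ r
  | grade1 i =>
    cases i with
    | inl i => exact Algebra.subset_adjoin (Or.inl ⟨i, rfl⟩)
    | inr i => exact Algebra.subset_adjoin (Or.inr ⟨i, rfl⟩)
  | mul a b ha hb => rw [map_mul]; exact Subalgebra.mul_mem _ (ha trivial) (hb trivial)
  | add a b ha hb => rw [map_add]; exact Subalgebra.add_mem _ (ha trivial) (hb trivial)

theorem generators_induction {p : WeylAlg n → Prop} (ht : ∀ i, p (t i)) (hd : ∀ i, p (d i))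
    (hc : ∀ c : ℂ, p (algebraMap ℂ _ c)) (hadd : ∀ x y, p x → p y → p (x + y))
    (hmul : ∀ x y, p x → p y → p (x * y)) (x : WeylAlg n) : p x := by
  have hx : x ∈ Algebra.adjoin ℂ (Set.range (t : Fin n → WeylAlg n) ∪ Set.range d) := by
    rw [adjoin_generators]; trivial
  induction hx using Algebra.adjoin_induction with
  | mem x hx =>
    rcases hx with ⟨i, rfl⟩ | ⟨i, rfl⟩
    · exact ht i
    · exact hd i
  | algebraMap r => exact hc r
  | add x y _ _ hx hy => exact hadd x y hx hy
  | mul x y _ _ hx hy => exact hmul x y hx hy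

/-- The representation of the Weyl algebra given by operators satisfying its defining relations. -/
noncomputable def rep {V : Type*} [AddCommGroup V] [Module ℂ V] (T D : Fin n → Module.End ℂ V)
    (hT : ∀ i j, T i * T j = T j * T i) (hD : ∀ i j, D i * D j = D j * D i)
    (hDT : ∀ i j, D i * T j = T j * D i + if i = j then 1 else 0) :
    WeylAlg n →ₐ[ℂ] Module.End ℂ V :=
  RingQuot.liftAlgHom ℂ ⟨FreeAlgebra.lift ℂ (Sum.elim T D), by
    intro x y h
    cases h with
    | t_comm i j => simpa using hT i j
    | d_comm i j => simpa using hD i j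
    | d_t i j =>
      simp only [map_mul, map_add, FreeAlgebra.lift_ι_apply, Sum.elim_inr, Sum.elim_inl, hDT]
      split_ifs <;> simp⟩

theorem rep_t {V : Type*} [AddCommGroup V] [Module ℂ V] {T D : Fin n → Module.End ℂ V}
    (hT : ∀ i j, T i * T j = T j * T i) (hD : ∀ i j, D i * D j = D j * D i)
    (hDT : ∀ i j, D i * T j = T j * D i + if i = j then 1 else 0) (i : Fin n) :
    rep T D hT hD hDT (t i) = T i :=
  (RingQuot.liftAlgHom_mkAlgHom_apply ..).trans (by simp)

theorem rep_d {V : Type*} [AddCommGroup V] [Module ℂ V] {T D : Fin n → Module.End ℂ V}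
    (hT : ∀ i j, T i * T j = T j * T i) (hD : ∀ i j, D i * D j = D j * D i)
    (hDT : ∀ i j, D i * T j = T j * D i + if i = j then 1 else 0) (i : Fin n) :
    rep T D hT hD hDT (d i) = D i :=
  (RingQuot.liftAlgHom_mkAlgHom_apply ..).trans (by simp)

theorem smul_mem_of_generators {V : Type*} [AddCommGroup V] [Module ℂ V] [Module (WeylAlg n) V]
    [IsScalarTower ℂ (WeylAlg n) V] {N : Submodule ℂ V}
    (ht : ∀ i, ∀ v ∈ N, (t i : WeylAlg n) • v ∈ N)
    (hd : ∀ i, ∀ v ∈ N, (d i : WeylAlg n) • v ∈ N) (x : WeylAlg n) : ∀ v ∈ N, x • v ∈ N := by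
  induction x using generators_induction with
  | ht i => exact ht i
  | hd i => exact hd i
  | hc c => intro v hv; rw [algebraMap_smul]; exact N.smul_mem c hv
  | hadd x y hx hy => intro v hv; rw [add_smul]; exact N.add_mem (hx v hv) (hy v hv)
  | hmul x y hx hy => intro v hv; rw [mul_smul]; exact hx _ (hy v hv)

end WeylAlg

/-! ### One pair of canonical generators -/

section OnePair

variable {R : Type*} [Ring R]

/-- The power `t ^ k` if `0 ≤ k`, and `d ^ (-k)` if `k ≤ 0`. -/
def ladder (t d : R) (k : ℤ) : R := t ^ k.toNat * d ^ (-k).toNat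

theorem ladder_zero (t d : R) : ladder t d 0 = 1 := by simp [ladder]

theorem ladder_natCast (t d : R) (k : ℕ) : ladder t d k = t ^ k := by simp [ladder]

theorem ladder_neg_natCast (t d : R) (k : ℕ) : ladder t d (-k) = d ^ k := by simp [ladder]

theorem Commute.ladder_right {x t d : R} (ht : Commute x t) (hd : Commute x d) (k : ℤ) :
    Commute x (ladder t d k) :=
  (ht.pow_right _).mul_right (hd.pow_right _)

variable [Algebra ℂ R] {V : Type*} [AddCommGroup V] [Module ℂ V] [Module R V]
  [IsScalarTower ℂ R V] {t d : R}

theorem euler_smul_t_pow (h : d * t = t * d + 1) {w : V} {lam : ℂ} (hw : (t * d) • w = lam • w)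
    (k : ℕ) : (t * d) • t ^ k • w = (lam + k) • t ^ k • w := by
  have : SMulCommClass ℂ R V := IsScalarTower.to_smulCommClass
  induction k with
  | zero => simpa using hw
  | succ k ih =>
    have e : t * d * t ^ (k + 1) = t * (t * d * t ^ k) + t ^ (k + 1) := by
      rw [pow_succ', ← mul_assoc, mul_assoc t d t, h]; noncomm_ring
    rw [← mul_smul, e, add_smul, mul_smul t, mul_smul (t * d), ih, smul_comm t, ← mul_smul,
      ← pow_succ', Nat.cast_succ, ← add_assoc, add_smul _ (1 : ℂ), one_smul]

theorem euler_smul_d_pow (h : d * t = t * d + 1) {w : V} {lam : ℂ} (hw : (t * d) • w = lam • w)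
    (k : ℕ) : (t * d) • d ^ k • w = (lam - k) • d ^ k • w := by
  have : SMulCommClass ℂ R V := IsScalarTower.to_smulCommClass
  induction k with
  | zero => simpa using hw
  | succ k ih =>
    have e : t * d * d ^ (k + 1) = d * (t * d * d ^ k) - d ^ (k + 1) := by
      have h' : t * d = d * t - 1 := by rw [h]; abel
      rw [pow_succ', ← mul_assoc (t * d), ← mul_assoc d]
      rw [show d * (t * d) = (d * t) * d by noncomm_ring, h]; noncomm_ring
    rw [← mul_smul, e, sub_smul, mul_smul d, mul_smul (t * d), ih, smul_comm d, ← mul_smul,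
      ← pow_succ', Nat.cast_succ, ← sub_sub, sub_smul _ (1 : ℂ), one_smul]

theorem d_smul_t_pow_succ (h : d * t = t * d + 1) {w : V} {lam : ℂ} (hw : (t * d) • w = lam • w)
    (k : ℕ) : d • t ^ (k + 1) • w = (lam + k + 1) • t ^ k • w := by
  rw [pow_succ', mul_smul, ← mul_smul d, h, add_smul, euler_smul_t_pow h hw, one_smul,
    add_smul _ (1 : ℂ), one_smul]

theorem t_smul_d_pow_succ (h : d * t = t * d + 1) {w : V} {lam : ℂ} (hw : (t * d) • w = lam • w)
    (k : ℕ) : t • d ^ (k + 1) • w = (lam - k) • d ^ k • w := by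
  rw [pow_succ', mul_smul, ← mul_smul t, euler_smul_d_pow h hw]

theorem exists_d_pow_smul_t_pow (h : d * t = t * d + 1) {w : V} {lam : ℂ}
    (hw : (t * d) • w = lam • w) (hl : ∀ j : ℕ, lam + j + 1 ≠ 0) (k : ℕ) :
    ∃ c : ℂ, c ≠ 0 ∧ d ^ k • t ^ k • w = c • w := by
  have : SMulCommClass ℂ R V := IsScalarTower.to_smulCommClass
  induction k with
  | zero => exact ⟨1, one_ne_zero, by simp⟩
  | succ k ih =>
    obtain ⟨c, hc, e⟩ := ih
    refine ⟨(lam + k + 1) * c, mul_ne_zero (hl k) hc, ?_⟩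
    rw [pow_succ d, mul_smul, d_smul_t_pow_succ h hw, smul_comm (d ^ k), e, mul_smul]

theorem exists_t_pow_smul_d_pow (h : d * t = t * d + 1) {w : V} {lam : ℂ}
    (hw : (t * d) • w = lam • w) (hl : ∀ j : ℕ, lam - j ≠ 0) (k : ℕ) :
    ∃ c : ℂ, c ≠ 0 ∧ t ^ k • d ^ k • w = c • w := by
  have : SMulCommClass ℂ R V := IsScalarTower.to_smulCommClass
  induction k with
  | zero => exact ⟨1, one_ne_zero, by simp⟩
  | succ k ih =>
    obtain ⟨c, hc, e⟩ := ih
    refine ⟨(lam - k) * c, mul_ne_zero (hl k) hc, ?_⟩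
    rw [pow_succ t, mul_smul, t_smul_d_pow_succ h hw, smul_comm (t ^ k), e, mul_smul]

/-- The vector `w` is an eigenvector of `t * d` with eigenvalue `lam`, and it is killed by `d`, or
killed by `t`, or `lam` is not an integer. Over the Weyl algebra of one pair of generators such a
vector, if nonzero, generates a simple module. The eigenvalue is recorded in the first two cases
because it is determined there only for `w ≠ 0`. -/
def IsVacuum (t d : R) (lam : ℂ) (w : V) : Prop :=
  (t * d) • w = lam • w ∧ ((d • w = 0 ∧ lam = 0) ∨ (t • w = 0 ∧ lam = -1) ∨ ∀ k : ℤ, lam ≠ k)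

theorem euler_smul_ladder (h : d * t = t * d + 1) {w : V} {lam : ℂ} (hw : (t * d) • w = lam • w)
    (k : ℤ) : (t * d) • ladder t d k • w = (lam + k) • ladder t d k • w := by
  obtain ⟨k, rfl | rfl⟩ := k.eq_nat_or_neg
  · rw [ladder_natCast]; exact_mod_cast euler_smul_t_pow h hw k
  · rw [ladder_neg_natCast, euler_smul_d_pow h hw k]; push_cast; rw [sub_eq_add_neg]

theorem exists_t_smul_ladder (h : d * t = t * d + 1) {w : V} {lam : ℂ}
    (hw : (t * d) • w = lam • w) (k : ℤ) :
    ∃ c : ℂ, t • ladder t d k • w = c • ladder t d (k + 1) • w := by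
  obtain ⟨k, rfl | rfl⟩ := k.eq_nat_or_neg
  · refine ⟨1, ?_⟩
    rw [← Nat.cast_succ, ladder_natCast, ladder_natCast, pow_succ', mul_smul, one_smul]
  · cases k with
    | zero => exact ⟨1, by simp [ladder]⟩
    | succ k =>
      refine ⟨lam - k, ?_⟩
      rw [ladder_neg_natCast, t_smul_d_pow_succ h hw]
      rw [show (-((k + 1 : ℕ) : ℤ) + 1) = -(k : ℤ) by push_cast; ring, ladder_neg_natCast]

theorem exists_d_smul_ladder (h : d * t = t * d + 1) {w : V} {lam : ℂ}
    (hw : (t * d) • w = lam • w) (k : ℤ) :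
    ∃ c : ℂ, d • ladder t d k • w = c • ladder t d (k - 1) • w := by
  obtain ⟨k, rfl | rfl⟩ := k.eq_nat_or_neg
  · cases k with
    | zero => exact ⟨1, by simp [ladder]⟩
    | succ k =>
      refine ⟨lam + k + 1, ?_⟩
      rw [ladder_natCast, d_smul_t_pow_succ h hw]
      rw [show (((k + 1 : ℕ) : ℤ) - 1) = (k : ℤ) by push_cast; ring, ladder_natCast]
  · refine ⟨1, ?_⟩
    rw [show (-(k : ℤ) - 1) = -((k + 1 : ℕ) : ℤ) by push_cast; ring, ladder_neg_natCast,
      ladder_neg_natCast, pow_succ', mul_smul, one_smul]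

theorem IsVacuum.exists_ladder_neg_smul (h : d * t = t * d + 1) {w : V} {lam : ℂ}
    (hw : IsVacuum t d lam w) (k : ℤ) (hk : ladder t d k • w ≠ 0) :
    ∃ c : ℂ, c ≠ 0 ∧ ladder t d (-k) • ladder t d k • w = c • w := by
  obtain ⟨k, rfl | rfl⟩ := k.eq_nat_or_neg
  · rw [ladder_neg_natCast, ladder_natCast]
    rw [ladder_natCast] at hk
    cases k with
    | zero => exact ⟨1, one_ne_zero, by simp⟩
    | succ k =>
      refine exists_d_pow_smul_t_pow h hw.1 (fun j => ?_) _
      rcases hw.2 with ⟨_, rfl⟩ | ⟨h0, _⟩ | hl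
      · rw [zero_add]; exact Nat.cast_add_one_ne_zero j
      · exact absurd (by rw [pow_succ, mul_smul, h0, smul_zero]) hk
      · intro h'; exact hl (-(j + 1)) (by push_cast; linear_combination h')
  · rw [neg_neg, ladder_neg_natCast, ladder_natCast]
    rw [ladder_neg_natCast] at hk
    cases k with
    | zero => exact ⟨1, one_ne_zero, by simp⟩
    | succ k =>
      refine exists_t_pow_smul_d_pow h hw.1 (fun j => ?_) _
      rcases hw.2 with ⟨h0, _⟩ | ⟨_, rfl⟩ | hl
      · exact absurd (by rw [pow_succ, mul_smul, h0, smul_zero]) hk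
      · intro h'
        exact Nat.cast_add_one_ne_zero (R := ℂ) j (by linear_combination -h')
      · intro h'; exact hl j (by push_cast; linear_combination h')

/-- Starting from a nonzero eigenvector of `t * d`, the ladder never breaks off in one of its two
directions, which depends on the eigenvalue only. -/
theorem exists_sign_ladder_smul_ne_zero (h : d * t = t * d + 1) (lam : ℂ) :
    ∃ s : ℤ, (s = 1 ∨ s = -1) ∧ ∀ w : V, (t * d) • w = lam • w → w ≠ 0 →
      ∀ k : ℤ, 0 ≤ s * k → ladder t d k • w ≠ 0 := by
  have : SMulCommClass ℂ R V := IsScalarTower.to_smulCommClass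
  by_cases hl : ∀ j : ℕ, lam + j + 1 ≠ 0
  · refine ⟨1, Or.inl rfl, fun w hw hne k hk h0 => ?_⟩
    lift k to ℕ using by simpa using hk
    obtain ⟨c, hc, e⟩ := exists_d_pow_smul_t_pow h hw hl k
    rw [ladder_natCast] at h0
    rw [h0, smul_zero] at e
    exact smul_ne_zero hc hne e.symm
  · have hl' : ∀ j : ℕ, lam - j ≠ 0 := by
      push Not at hl
      obtain ⟨i, hi⟩ := hl
      intro j hj
      have : ((i + j + 1 : ℕ) : ℂ) = 0 := by push_cast; linear_combination hi - hj
      exact absurd this (Nat.cast_ne_zero.2 (by omega))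
    refine ⟨-1, Or.inr rfl, fun w hw hne k hk h0 => ?_⟩
    obtain ⟨k, rfl⟩ : ∃ m : ℕ, k = -m := ⟨(-k).toNat, by omega⟩
    obtain ⟨c, hc, e⟩ := exists_t_pow_smul_d_pow h hw hl' k
    rw [ladder_neg_natCast] at h0
    rw [h0, smul_zero] at e
    exact smul_ne_zero hc hne e.symm

end OnePair

/-! ### The simple weight module generated by a vacuum vector -/

namespace WeylAlg

variable {n : ℕ}

theorem d_mul_t_self (i : Fin n) : (d i * t i : WeylAlg n) = t i * d i + 1 := by
  rw [d_mul_t, if_pos rfl]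

theorem commute_d_t {i j : Fin n} (h : i ≠ j) : Commute (d i : WeylAlg n) (t j) := by
  rw [Commute, SemiconjBy, d_mul_t, if_neg h, add_zero]

theorem commute_ladder {i j : Fin n} (h : i ≠ j) (a b : ℤ) :
    Commute (ladder (t i : WeylAlg n) (d i) a) (ladder (t j) (d j) b) :=
  Commute.ladder_right
    (Commute.ladder_right (t_mul_t j i) (commute_d_t h).symm a).symm
    (Commute.ladder_right (commute_d_t h.symm) (d_mul_d j i) a).symm b

theorem pairwise_commute_ladder (s : Set (Fin n)) (k : Fin n → ℤ) :
    s.Pairwise (Function.onFun Commute fun i => ladder (t i : WeylAlg n) (d i) (k i)) :=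
  fun _ _ _ _ h => commute_ladder h _ _

/-- The product over all `i` of `t i ^ k i` or `d i ^ (-k i)`, according to the sign of `k i`. -/
noncomputable def ladders (k : Fin n → ℤ) : WeylAlg n :=
  Finset.univ.noncommProd (fun i => ladder (t i) (d i) (k i)) (pairwise_commute_ladder _ k)

/-- The product `ladders k` without its `i`-th factor. -/
noncomputable def laddersErase (i : Fin n) (k : Fin n → ℤ) : WeylAlg n :=
  (Finset.univ.erase i).noncommProd (fun i => ladder (t i) (d i) (k i))
    (pairwise_commute_ladder _ k)

theorem ladders_eq (i : Fin n) (k : Fin n → ℤ) :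
    ladders k = ladder (t i) (d i) (k i) * laddersErase i k :=
  (Finset.mul_noncommProd_erase _ (Finset.mem_univ i) _ _).symm

theorem laddersErase_update (i : Fin n) (k : Fin n → ℤ) (a : ℤ) :
    laddersErase i (Function.update k i a) = laddersErase i k :=
  Finset.noncommProd_congr rfl
    (fun j hj => by rw [Function.update_of_ne (Finset.ne_of_mem_erase hj)]) _

theorem ladders_update (i : Fin n) (k : Fin n → ℤ) (a : ℤ) :
    ladders (Function.update k i a) = ladder (t i) (d i) a * laddersErase i k := by
  rw [ladders_eq i, laddersErase_update, Function.update_self]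

theorem ladders_zero : ladders (0 : Fin n → ℤ) = 1 := by
  refine Finset.noncommProd_induction _ _ _ (fun x => x = 1) ?_ rfl ?_
  · rintro _ _ rfl rfl; exact one_mul 1
  · intro i _; exact ladder_zero _ _

theorem commute_t_laddersErase (i : Fin n) (k : Fin n → ℤ) : Commute (t i) (laddersErase i k) :=
  Finset.noncommProd_commute _ _ _ _ fun j hj => Commute.ladder_right (t_mul_t i j)
    (commute_d_t (Finset.ne_of_mem_erase hj)).symm _

theorem commute_d_laddersErase (i : Fin n) (k : Fin n → ℤ) : Commute (d i) (laddersErase i k) :=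
  Finset.noncommProd_commute _ _ _ _ fun j hj => Commute.ladder_right
    (commute_d_t (Finset.ne_of_mem_erase hj).symm) (d_mul_d i j) _

end WeylAlg

open WeylAlg

theorem IsVacuum.smul {R : Type*} [Ring R] [Algebra ℂ R] {V : Type*} [AddCommGroup V] [Module ℂ V]
    [Module R V] [IsScalarTower ℂ R V] {t d x : R} {lam : ℂ} {w : V} (hw : IsVacuum t d lam w)
    (ht : Commute t x) (hd : Commute d x) : IsVacuum t d lam (x • w) := by
  have : SMulCommClass ℂ R V := IsScalarTower.to_smulCommClass
  have key : ∀ y : R, Commute y x → y • x • w = x • y • w := fun y hy => by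
    rw [← mul_smul, hy.eq, mul_smul]
  refine ⟨by rw [key _ (ht.mul_left hd), hw.1, smul_comm], ?_⟩
  rcases hw.2 with ⟨h, h'⟩ | ⟨h, h'⟩ | h
  · exact Or.inl ⟨by rw [key _ hd, h, smul_zero], h'⟩
  · exact Or.inr (Or.inl ⟨by rw [key _ ht, h, smul_zero], h'⟩)
  · exact Or.inr (Or.inr h)

section Vacuum

variable {n : ℕ} {V : Type*} [AddCommGroup V] [Module ℂ V] [Module (WeylAlg n) V]
  [IsScalarTower ℂ (WeylAlg n) V] {v : V} {lam : Fin n → ℂ}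

theorem weylEulerOp_apply (i : Fin n) (v : V) :
    weylEulerOp n V i v = (t i * d i : WeylAlg n) • v := rfl

theorem isVacuum_laddersErase (hv : ∀ i, IsVacuum (t i : WeylAlg n) (d i) (lam i) v) (i : Fin n)
    (k : Fin n → ℤ) : IsVacuum (t i : WeylAlg n) (d i) (lam i) (laddersErase i k • v) :=
  (hv i).smul (commute_t_laddersErase i k) (commute_d_laddersErase i k)

theorem t_smul_ladders_mem (hv : ∀ i, IsVacuum (t i : WeylAlg n) (d i) (lam i) v) (i : Fin n)
    (k : Fin n → ℤ) :
    ∃ k', (t i : WeylAlg n) • (ladders k : WeylAlg n) • v ∈ ℂ ∙ ((ladders k' : WeylAlg n) • v) := by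
  refine ⟨Function.update k i (k i + 1), Submodule.mem_span_singleton.2 ?_⟩
  obtain ⟨c, hc⟩ := exists_t_smul_ladder (d_mul_t_self i) (isVacuum_laddersErase hv i k).1 (k i)
  exact ⟨c, by rw [ladders_update, ladders_eq i k, mul_smul, mul_smul, hc]⟩

theorem d_smul_ladders_mem (hv : ∀ i, IsVacuum (t i : WeylAlg n) (d i) (lam i) v) (i : Fin n)
    (k : Fin n → ℤ) :
    ∃ k', (d i : WeylAlg n) • (ladders k : WeylAlg n) • v ∈ ℂ ∙ ((ladders k' : WeylAlg n) • v) := by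
  refine ⟨Function.update k i (k i - 1), Submodule.mem_span_singleton.2 ?_⟩
  obtain ⟨c, hc⟩ := exists_d_smul_ladder (d_mul_t_self i) (isVacuum_laddersErase hv i k).1 (k i)
  exact ⟨c, by rw [ladders_update, ladders_eq i k, mul_smul, mul_smul, hc]⟩

theorem ladders_smul_mem_weightSpace (hv : ∀ i, IsVacuum (t i : WeylAlg n) (d i) (lam i) v)
    (k : Fin n → ℤ) :
    (ladders k : WeylAlg n) • v ∈ weightSpace (weylEulerOp n V) fun i => lam i + k i := by
  intro i
  rw [weylEulerOp_apply, ladders_eq i k, mul_smul (ladder _ _ _)]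
  exact euler_smul_ladder (d_mul_t_self i) (isVacuum_laddersErase hv i k).1 (k i)

theorem exists_smul_ladders_eq (hv : ∀ i, IsVacuum (t i : WeylAlg n) (d i) (lam i) v)
    (k : Fin n → ℤ) (hk : (ladders k : WeylAlg n) • v ≠ 0) :
    ∃ x : WeylAlg n, x • (ladders k : WeylAlg n) • v = v := by
  classical
  suffices h : ∀ (s : Finset (Fin n)) (k : Fin n → ℤ), (∀ i ∉ s, k i = 0) →
      (ladders k : WeylAlg n) • v ≠ 0 → ∃ x : WeylAlg n, x • (ladders k : WeylAlg n) • v = v from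
    h Finset.univ k (by simp) hk
  intro s
  induction s using Finset.induction_on with
  | empty =>
    intro k hk _
    obtain rfl : k = 0 := funext fun i => hk i (Finset.notMem_empty i)
    exact ⟨1, by rw [ladders_zero, one_smul, one_smul]⟩
  | insert a s ha ih =>
    intro k hk hne
    have e : (ladders k : WeylAlg n) • v =
        (ladder (t a) (d a) (k a) : WeylAlg n) • (laddersErase a k : WeylAlg n) • v := by
      rw [ladders_eq a, mul_smul]
    have e' : (ladders (Function.update k a 0) : WeylAlg n) • v =
        (laddersErase a k : WeylAlg n) • v := by
      rw [ladders_update, ladder_zero, one_mul]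
    rw [e] at hne
    obtain ⟨c, hc, h⟩ := (isVacuum_laddersErase hv a k).exists_ladder_neg_smul (d_mul_t_self a)
      (k a) hne
    obtain ⟨x, hx⟩ := ih (Function.update k a 0) (fun i hi => by
        by_cases hia : i = a
        · rw [hia, Function.update_self]
        · rw [Function.update_of_ne hia]
          exact hk i (by simp [hia, hi]))
      (by rw [e']; intro h0; exact hne (by rw [h0, smul_zero]))
    refine ⟨c⁻¹ • (x * ladder (t a) (d a) (-k a)), ?_⟩
    have : SMulCommClass ℂ (WeylAlg n) V := IsScalarTower.to_smulCommClass
    rw [e, smul_assoc, mul_smul, h, smul_comm x, ← e', hx, inv_smul_smul₀ hc]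

theorem exists_sign_ladders_smul_ne_zero (hv : ∀ i, IsVacuum (t i : WeylAlg n) (d i) (lam i) v)
    (hne : v ≠ 0) : ∃ s : Fin n → ℤ, (∀ i, s i = 1 ∨ s i = -1) ∧
      ∀ k : Fin n → ℤ, (∀ i, 0 ≤ s i * k i) → (ladders k : WeylAlg n) • v ≠ 0 := by
  classical
  choose s hs hs' using fun i : Fin n =>
    exists_sign_ladder_smul_ne_zero (V := V) (d_mul_t_self (n := n) i) (lam i)
  refine ⟨s, hs, fun k hk => ?_⟩
  suffices h : ∀ (s' : Finset (Fin n)) (k : Fin n → ℤ), (∀ i ∉ s', k i = 0) →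
      (∀ i, 0 ≤ s i * k i) → (ladders k : WeylAlg n) • v ≠ 0 from h Finset.univ k (by simp) hk
  intro s'
  induction s' using Finset.induction_on with
  | empty =>
    intro k hk _
    obtain rfl : k = 0 := funext fun i => hk i (Finset.notMem_empty i)
    rwa [ladders_zero, one_smul]
  | insert a s' ha ih =>
    intro k hk hpos
    rw [ladders_eq a, mul_smul]
    refine hs' a _ (isVacuum_laddersErase hv a k).1 ?_ _ (hpos a)
    have h := ih (Function.update k a 0) (fun i hi => by
        by_cases hia : i = a
        · rw [hia, Function.update_self]
        · rw [Function.update_of_ne hia]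
          exact hk i (by simp [hia, hi]))
      (fun i => by
        by_cases hia : i = a
        · rw [hia, Function.update_self, mul_zero]
        · rw [Function.update_of_ne hia]; exact hpos i)
    rwa [ladders_update, ladder_zero, one_mul] at h

theorem weights_injective (lam : Fin n → ℂ) :
    Function.Injective fun (k : Fin n → ℤ) (i : Fin n) => lam i + (k i : ℂ) := by
  intro k k' h
  funext i
  exact_mod_cast add_left_cancel (congrFun h i)

theorem restrictScalars_span_eq_iSup (hv : ∀ i, IsVacuum (t i : WeylAlg n) (d i) (lam i) v) :
    (Submodule.span (WeylAlg n) {v}).restrictScalars ℂ =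
      ⨆ k : Fin n → ℤ, ℂ ∙ ((ladders k : WeylAlg n) • v) := by
  have : SMulCommClass ℂ (WeylAlg n) V := IsScalarTower.to_smulCommClass
  apply le_antisymm
  · intro x hx
    obtain ⟨y, rfl⟩ := Submodule.mem_span_singleton.1 hx
    refine smul_mem_of_generators (N := ⨆ k : Fin n → ℤ, ℂ ∙ ((ladders k : WeylAlg n) • v))
      ?_ ?_ y v ?_
    · intro i w hw
      induction hw using Submodule.iSup_induction' with
      | mem k w hw =>
        obtain ⟨c, rfl⟩ := Submodule.mem_span_singleton.1 hw
        obtain ⟨k', h⟩ := t_smul_ladders_mem hv i k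
        rw [smul_comm]
        exact Submodule.smul_mem _ _ (Submodule.mem_iSup_of_mem k' h)
      | zero => rw [smul_zero]; exact Submodule.zero_mem _
      | add x y _ _ hx hy => rw [smul_add]; exact Submodule.add_mem _ hx hy
    · intro i w hw
      induction hw using Submodule.iSup_induction' with
      | mem k w hw =>
        obtain ⟨c, rfl⟩ := Submodule.mem_span_singleton.1 hw
        obtain ⟨k', h⟩ := d_smul_ladders_mem hv i k
        rw [smul_comm]
        exact Submodule.smul_mem _ _ (Submodule.mem_iSup_of_mem k' h)
      | zero => rw [smul_zero]; exact Submodule.zero_mem _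
      | add x y _ _ hx hy => rw [smul_add]; exact Submodule.add_mem _ hx hy
    · refine Submodule.mem_iSup_of_mem 0 ?_
      rw [ladders_zero, one_smul]
      exact Submodule.mem_span_singleton_self v
  · refine iSup_le fun k => (Submodule.span_singleton_le_iff_mem _ _).2 ?_
    exact Submodule.smul_mem _ _ (Submodule.mem_span_singleton_self v)

theorem isSimpleModule_span (hv : ∀ i, IsVacuum (t i : WeylAlg n) (d i) (lam i) v) (hne : v ≠ 0) :
    IsSimpleModule (WeylAlg n) (Submodule.span (WeylAlg n) {v}) := by
  rw [isSimpleModule_iff_isAtom]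
  refine ⟨fun h => hne (Submodule.span_singleton_eq_bot.1 h), fun N hN => ?_⟩
  by_contra hN0
  apply hN.not_ge
  rw [Submodule.span_singleton_le_iff_mem]
  have h := le_iSup_inf_of_invariant (N := N.restrictScalars ℂ) (d := weylEulerOp n V)
    (fun i w hw => N.smul_mem _ hw) (weights_injective lam)
    (fun k => (Submodule.span_singleton_le_iff_mem _ _).2 (ladders_smul_mem_weightSpace hv k))
    (by rw [← restrictScalars_span_eq_iSup hv]; exact hN.le)
  obtain ⟨k, hk⟩ : ∃ k : Fin n → ℤ,
      ℂ ∙ ((ladders k : WeylAlg n) • v) ⊓ N.restrictScalars ℂ ≠ ⊥ := by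
    by_contra! hbot
    rw [iSup_eq_bot.2 hbot, le_bot_iff, Submodule.restrictScalars_eq_bot_iff] at h
    exact hN0 h
  obtain ⟨x, ⟨hx, hxN⟩, hx0⟩ := Submodule.exists_mem_ne_zero_of_ne_bot hk
  obtain ⟨c, rfl⟩ := Submodule.mem_span_singleton.1 hx
  have hc : c ≠ 0 := fun h0 => hx0 (by rw [h0, zero_smul])
  have hm : (ladders k : WeylAlg n) • v ∈ N :=
    ((N.restrictScalars ℂ).smul_mem_iff hc).1 hxN
  obtain ⟨y, hy⟩ := exists_smul_ladders_eq hv k (fun h0 => hx0 (by rw [h0, smul_zero]))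
  rw [← hy]
  exact N.smul_mem y hm

theorem iSup_span_ladders_eq_top (hv : ∀ i, IsVacuum (t i : WeylAlg n) (d i) (lam i) v)
    (htop : Submodule.span (WeylAlg n) {v} = ⊤) :
    ⨆ k : Fin n → ℤ, ℂ ∙ ((ladders k : WeylAlg n) • v) = ⊤ := by
  rw [← restrictScalars_span_eq_iSup hv, htop, Submodule.restrictScalars_top]

theorem isWeight_of_span_eq_top (hv : ∀ i, IsVacuum (t i : WeylAlg n) (d i) (lam i) v)
    (htop : Submodule.span (WeylAlg n) {v} = ⊤) : IsWeight (weylEulerOp n V) := by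
  refine ⟨iSupIndep_weightSpace _, top_le_iff.1 ?_⟩
  rw [← iSup_span_ladders_eq_top hv htop]
  exact iSup_le fun k => le_iSup_of_le _
    ((Submodule.span_singleton_le_iff_mem _ _).2 (ladders_smul_mem_weightSpace hv k))

end Vacuum

/-! ### Existence of vacuum vectors -/

theorem exists_ne_zero_mem_weightSpace {n : ℕ} {V : Type*} [AddCommGroup V] [Module ℂ V]
    {d : Fin n → Module.End ℂ V} (hd : ∀ i j, Commute (d i) (d j)) (W : Submodule ℂ V)
    [FiniteDimensional ℂ W] (hW : W ≠ ⊥) (hdW : ∀ i, ∀ v ∈ W, d i v ∈ W) :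
    ∃ v ≠ 0, ∃ α, v ∈ weightSpace d α := by
  classical
  suffices h : ∀ s : Finset (Fin n), ∃ v ∈ W, v ≠ 0 ∧ ∃ α : Fin n → ℂ, ∀ i ∈ s, d i v = α i • v by
    obtain ⟨v, _, hv, α, hα⟩ := h Finset.univ
    exact ⟨v, hv, α, fun i => hα i (Finset.mem_univ i)⟩
  intro s
  induction s using Finset.induction_on with
  | empty =>
    obtain ⟨v, hv, hv0⟩ := Submodule.exists_mem_ne_zero_of_ne_bot hW
    exact ⟨v, hv, hv0, 0, by simp⟩
  | insert a s ha ih =>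
    obtain ⟨v, hvW, hv0, α, hα⟩ := ih
    let W' : Submodule ℂ V :=
      { carrier := {w | w ∈ W ∧ ∀ i ∈ s, d i w = α i • w}
        add_mem' := fun {x y} hx hy => ⟨W.add_mem hx.1 hy.1, fun i hi => by
          rw [map_add, hx.2 i hi, hy.2 i hi, smul_add]⟩
        zero_mem' := ⟨W.zero_mem, by simp⟩
        smul_mem' := fun c x hx => ⟨W.smul_mem c hx.1, fun i hi => by
          rw [map_smul, hx.2 i hi, smul_comm]⟩ }
    have hmaps : ∀ w ∈ W', d a w ∈ W' := fun w hw => ⟨hdW a w hw.1, fun i hi => by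
      rw [← Module.End.mul_apply, (hd i a).eq, Module.End.mul_apply, hw.2 i hi, map_smul]⟩
    have : FiniteDimensional ℂ W' := Submodule.finiteDimensional_of_le (S₂ := W) fun w hw => hw.1
    have : Nontrivial W' :=
      ⟨⟨⟨v, hvW, hα⟩, 0, fun h => hv0 (congrArg Subtype.val h)⟩⟩
    obtain ⟨c, hc⟩ := Module.End.exists_eigenvalue ((d a).restrict hmaps)
    obtain ⟨w, hw⟩ := hc.exists_hasEigenvector
    have hwa : d a w = c • (w : V) := congrArg Subtype.val hw.apply_eq_smul
    refine ⟨w, w.2.1, fun h => hw.2 (Subtype.ext h), Function.update α a c, fun i hi => ?_⟩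
    by_cases hia : i = a
    · rw [hia, Function.update_self, hwa]
    · rw [Function.update_of_ne hia]
      exact w.2.2 i (Finset.mem_of_mem_insert_of_ne hi hia)

theorem exists_isVacuum_ladder_smul {R : Type*} [Ring R] [Algebra ℂ R] {V : Type*} [AddCommGroup V]
    [Module ℂ V] [Module R V] [IsScalarTower ℂ R V] {t d : R} (h : d * t = t * d + 1) {w : V}
    {lam : ℂ} (hw : (t * d) • w = lam • w) (hne : w ≠ 0) :
    ∃ k : ℤ, ladder t d k • w ≠ 0 ∧ IsVacuum t d (lam + k) (ladder t d k • w) := by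
  -- A vector killed by `d` or by `t` has eigenvalue `0` or `-1` by itself.
  have kd : ∀ k : ℤ, ladder t d k • w ≠ 0 → d • ladder t d k • w = 0 →
      IsVacuum t d (lam + k) (ladder t d k • w) := by
    intro k hk hd
    have e := euler_smul_ladder h hw k
    refine ⟨e, Or.inl ⟨hd, ?_⟩⟩
    rw [mul_smul, hd, smul_zero] at e
    exact (smul_eq_zero.1 e.symm).resolve_right hk
  have kt : ∀ k : ℤ, ladder t d k • w ≠ 0 → t • ladder t d k • w = 0 →
      IsVacuum t d (lam + k) (ladder t d k • w) := by
    intro k hk ht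
    have e := euler_smul_ladder h hw k
    refine ⟨e, Or.inr (Or.inl ⟨ht, ?_⟩)⟩
    have h' : t * d = d * t - 1 := by rw [h]; abel
    rw [h', sub_smul, mul_smul, ht, smul_zero, one_smul, zero_sub, neg_eq_iff_add_eq_zero,
      ← one_smul ℂ (ladder t d k • w), smul_smul, mul_one, ← add_smul] at e
    exact (eq_neg_of_add_eq_zero_right ((smul_eq_zero.1 e).resolve_right hk))
  by_cases hint : ∀ k : ℤ, lam ≠ k
  · exact ⟨0, by rwa [ladder_zero, one_smul], by
      rw [ladder_zero, one_smul, Int.cast_zero, add_zero]; exact ⟨hw, Or.inr (Or.inr hint)⟩⟩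
  by_cases hd : ∃ k : ℕ, d ^ k • w = 0
  · classical
    obtain ⟨k, hk, hk'⟩ : ∃ k, d ^ k • w ≠ 0 ∧ d ^ (k + 1) • w = 0 := by
      have hpos : Nat.find hd ≠ 0 := fun h0 => hne (by simpa [h0] using Nat.find_spec hd)
      exact ⟨Nat.find hd - 1, Nat.find_min hd (by omega), by
        rw [Nat.sub_add_cancel (by omega)]; exact Nat.find_spec hd⟩
    have hk0 : ladder t d (-k) • w ≠ 0 := by rwa [ladder_neg_natCast]
    refine ⟨-k, hk0, kd _ hk0 ?_⟩
    rw [ladder_neg_natCast, ← mul_smul, ← pow_succ', hk']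
  by_cases ht : ∃ k : ℕ, t ^ k • w = 0
  · classical
    obtain ⟨k, hk, hk'⟩ : ∃ k, t ^ k • w ≠ 0 ∧ t ^ (k + 1) • w = 0 := by
      have hpos : Nat.find ht ≠ 0 := fun h0 => hne (by simpa [h0] using Nat.find_spec ht)
      exact ⟨Nat.find ht - 1, Nat.find_min ht (by omega), by
        rw [Nat.sub_add_cancel (by omega)]; exact Nat.find_spec ht⟩
    have hk0 : ladder t d k • w ≠ 0 := by rwa [ladder_natCast]
    refine ⟨k, hk0, kt _ hk0 ?_⟩
    rw [ladder_natCast, ← mul_smul, ← pow_succ', hk']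
  -- Both ladders are infinite: walk to the place where `t` or `d` has to act by zero.
  push Not at hd ht hint
  obtain ⟨m, rfl⟩ := hint
  obtain ⟨m, rfl⟩ | ⟨m, rfl⟩ : (∃ j : ℕ, m = j) ∨ ∃ j : ℕ, m = -(j + 1 : ℕ) := by
    rcases le_or_gt 0 m with h0 | h0
    · exact Or.inl ⟨m.toNat, by omega⟩
    · exact Or.inr ⟨(-m).toNat - 1, by omega⟩
  · have hk0 : ladder t d (-(m + 1 : ℕ)) • w ≠ 0 := by rw [ladder_neg_natCast]; exact hd _
    refine ⟨_, hk0, kt _ hk0 ?_⟩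
    rw [ladder_neg_natCast, t_smul_d_pow_succ h hw, Int.cast_natCast, sub_self, zero_smul]
  · have hk0 : ladder t d (m + 1 : ℕ) • w ≠ 0 := by rw [ladder_natCast]; exact ht _
    refine ⟨_, hk0, kd _ hk0 ?_⟩
    rw [ladder_natCast, d_smul_t_pow_succ h hw]
    push_cast
    rw [show -((m : ℂ) + 1) + m + 1 = 0 by ring, zero_smul]

theorem exists_isVacuum {n : ℕ} {V : Type*} [AddCommGroup V] [Module ℂ V] [Module (WeylAlg n) V]
    [IsScalarTower ℂ (WeylAlg n) V] {v : V} (hv : v ≠ 0) {α : Fin n → ℂ}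
    (hvα : v ∈ weightSpace (weylEulerOp n V) α) :
    ∃ v : V, v ≠ 0 ∧ ∃ lam : Fin n → ℂ, ∀ i, IsVacuum (t i : WeylAlg n) (d i) (lam i) v := by
  classical
  have : SMulCommClass ℂ (WeylAlg n) V := IsScalarTower.to_smulCommClass
  suffices h : ∀ s : Finset (Fin n), ∃ v : V, v ≠ 0 ∧ ∃ lam : Fin n → ℂ,
      (∀ i, (t i * d i : WeylAlg n) • v = lam i • v) ∧
        ∀ i ∈ s, IsVacuum (t i : WeylAlg n) (d i) (lam i) v by
    obtain ⟨v, hv, lam, _, h⟩ := h Finset.univ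
    exact ⟨v, hv, lam, fun i => h i (Finset.mem_univ i)⟩
  intro s
  induction s using Finset.induction_on with
  | empty => exact ⟨v, hv, α, hvα, by simp⟩
  | insert a s ha ih =>
    obtain ⟨w, hw, lam, hlam, hs⟩ := ih
    obtain ⟨k, hk, hvac⟩ := exists_isVacuum_ladder_smul (d_mul_t_self a) (hlam a) hw
    have ct : ∀ i ≠ a, Commute (t i : WeylAlg n) (ladder (t a) (d a) k) := fun i hi =>
      Commute.ladder_right (t_mul_t i a) (commute_d_t (Ne.symm hi)).symm k
    have cd : ∀ i ≠ a, Commute (d i : WeylAlg n) (ladder (t a) (d a) k) := fun i hi =>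
      Commute.ladder_right (commute_d_t hi) (d_mul_d i a) k
    refine ⟨_, hk, Function.update lam a (lam a + k), fun i => ?_, fun i hi => ?_⟩
    · by_cases hia : i = a
      · rw [hia, Function.update_self]; exact hvac.1
      · rw [Function.update_of_ne hia, ← mul_smul, ((ct i hia).mul_left (cd i hia)).eq, mul_smul,
          hlam i, smul_comm]
    · by_cases hia : i = a
      · rw [hia, Function.update_self]; exact hvac
      · rw [Function.update_of_ne hia]
        exact (hs i (Finset.mem_of_mem_insert_of_ne hi hia)).smul (ct i hia) (cd i hia)

/-! ### `AW_n^+` modules as modules over the Weyl algebra -/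

theorem derivation_eq_sum {n : ℕ} (D : WittPlus n) :
    D = ∑ j, D (MvPolynomial.X j) • (MvPolynomial.pderiv j : WittPlus n) := by
  apply MvPolynomial.derivation_ext
  intro i
  rw [derivation_sum_apply]
  simp [MvPolynomial.pderiv_X, Pi.single_apply]

theorem pderiv_lie_pderiv {n : ℕ} (i j : Fin n) :
    ⁅(MvPolynomial.pderiv i : WittPlus n), (MvPolynomial.pderiv j : WittPlus n)⁆ = 0 := by
  apply MvPolynomial.derivation_ext
  intro k
  rw [Derivation.commutator_apply]
  simp [MvPolynomial.pderiv_X, Pi.single_apply, apply_ite]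

theorem lie_smul_pderiv {n : ℕ} (k j : Fin n) (g : PolyAlg n) :
    ⁅(MvPolynomial.pderiv k : WittPlus n), g • (MvPolynomial.pderiv j : WittPlus n)⁆ =
      MvPolynomial.pderiv k g • (MvPolynomial.pderiv j : WittPlus n) := by
  apply MvPolynomial.derivation_ext
  intro i
  rw [Derivation.commutator_apply]
  by_cases h : i = j
  · subst h
    simp [MvPolynomial.pderiv_X, Pi.single_apply, apply_ite]
  · simp [MvPolynomial.pderiv_X, Pi.single_apply, apply_ite, h]

theorem WeylAlg.ofWitt_pderiv {n : ℕ} (i : Fin n) :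
    ofWitt (MvPolynomial.pderiv i : WittPlus n) = d i := by
  simp [ofWitt, MvPolynomial.pderiv_X, Pi.single_apply, apply_ite (ofPoly (n := n)), ite_mul]

section Action

set_option linter.unusedSectionVars false

variable (n : ℕ) (V : Type*) [AddCommGroup V] [Module ℂ V] [LieRingModule (ExtWitt n) V]
  [LieModule ℂ (ExtWitt n) V]

/-- The representation of the Witt algebra on a module over `W_n^+ ⋉ A_n^+`. -/
noncomputable def wittEnd : WittPlus n →ₗ⁅ℂ⁆ Module.End ℂ V :=
  (LieModule.toEnd ℂ (ExtWitt n) V).comp (LieAlgebra.SemiDirectSum.inr (wittAction n))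

variable {n V}

theorem wittEnd_apply (D : WittPlus n) (v : V) : wittEnd n V D v = ⁅wittElt D, v⁆ := rfl

theorem wittEnd_lie (D E : WittPlus n) :
    wittEnd n V ⁅D, E⁆ = wittEnd n V D * wittEnd n V E - wittEnd n V E * wittEnd n V D := by
  rw [LieHom.map_lie, LieRing.of_associative_ring_bracket]

theorem lie_wittElt_polyElt (D : WittPlus n) (f : PolyAlg n) :
    ⁅wittElt D, polyElt f⁆ = polyElt (D f) := by
  have h : wittAction n D f = D f := rfl
  change (⟨⁅(0 : PolyAlg n), f⁆ + wittAction n D f - wittAction n 0 0, ⁅D, 0⁆⟩ : ExtWitt n) =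
    ⟨D f, 0⟩
  rw [h, zero_lie, map_zero, zero_add]
  exact congrArg₂ LieAlgebra.SemiDirectSum.mk (sub_zero _) (lie_zero D)

theorem lie_eq_add (x : ExtWitt n) (v : V) :
    ⁅x, v⁆ = ⁅polyElt x.left, v⁆ + ⁅wittElt x.right, v⁆ := by
  rw [← add_lie]
  congr 1
  ext <;> simp

variable [Module (WeylAlg n) V] [IsScalarTower ℂ (WeylAlg n) V]

variable (n V) in
/-- The Weyl algebra acts on the module `V` over `W_n^+ ⋉ A_n^+` through the action of the
polynomials and of the constant vector fields. -/
structure IsWeylCompatible : Prop where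
  ofPoly_smul : ∀ (f : PolyAlg n) (v : V), (ofPoly f : WeylAlg n) • v = ⁅polyElt f, v⁆
  d_smul : ∀ (i : Fin n) (v : V), (d i : WeylAlg n) • v = ⁅wittElt (MvPolynomial.pderiv i), v⁆

variable (n V) in
/-- The representation of the Weyl algebra, by `ℂ`-linear operators. -/
noncomputable def weylEnd : WeylAlg n →ₐ[ℂ] Module.End ℂ V := Algebra.lsmul ℂ ℂ V

theorem weylEnd_apply (x : WeylAlg n) (v : V) : weylEnd n V x v = x • v := rfl

theorem IsWeylCompatible.wittEnd_mul_ofPoly (h : IsWeylCompatible n V) (D : WittPlus n)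
    (f : PolyAlg n) : wittEnd n V D * weylEnd n V (ofPoly f) =
      weylEnd n V (ofPoly f) * wittEnd n V D + weylEnd n V (ofPoly (D f)) := by
  ext v
  simp only [Module.End.mul_apply, LinearMap.add_apply, weylEnd_apply, wittEnd_apply,
    h.ofPoly_smul]
  rw [leibniz_lie, lie_wittElt_polyElt, add_comm]

theorem IsWeylCompatible.wittEnd_pderiv (h : IsWeylCompatible n V) (i : Fin n) :
    wittEnd n V (MvPolynomial.pderiv i) = weylEnd n V (d i) := by
  ext v
  exact (h.d_smul i v).symm

theorem IsWeylCompatible.d_mul_wittEnd (h : IsWeylCompatible n V) (i : Fin n) (D : WittPlus n) :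
    weylEnd n V (d i) * wittEnd n V D =
      wittEnd n V D * weylEnd n V (d i) +
        wittEnd n V ⁅(MvPolynomial.pderiv i : WittPlus n), D⁆ := by
  rw [← h.wittEnd_pderiv i, wittEnd_lie]
  abel

theorem commute_weylEnd_of_generators {φ : Module.End ℂ V}
    (ht : ∀ i, Commute φ (weylEnd n V (t i))) (hd : ∀ i, Commute φ (weylEnd n V (d i)))
    (x : WeylAlg n) : Commute φ (weylEnd n V x) := by
  induction x using generators_induction with
  | ht i => exact ht i
  | hd i => exact hd i
  | hc c => rw [AlgHom.commutes]; exact (Algebra.commutes c φ).symm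
  | hadd x y hx hy => rw [map_add]; exact hx.add_right hy
  | hmul x y hx hy => rw [map_mul]; exact hx.mul_right hy

/-- Taylor expansion, in a form that avoids its coefficients. Consider linear maps `L` from
polynomials to operators such that `[∂_k, L g] = L (∂_k g)` and `[L g, t_k] = c_k g`; an example is
`g ↦ g ∂_j`. Up to a combination of the `∂_k`, the operator `L 1` commutes with the Weyl
algebra. The map `g ↦ L (t_i g) - t_i L g` is again of this kind, whence an induction on `g`
expresses `L g` through the Weyl algebra and operators commuting with it. -/
theorem apply_mem_of_commutant {N : Submodule ℂ V}
    (hK : ∀ (x : WeylAlg n), ∀ v ∈ N, x • v ∈ N)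
    (hC : ∀ φ : Module.End ℂ V, (∀ x : WeylAlg n, Commute φ (weylEnd n V x)) → ∀ v ∈ N, φ v ∈ N)
    (g : PolyAlg n) : ∀ (L : PolyAlg n →ₗ[ℂ] Module.End ℂ V) (c : Fin n → ℂ),
    (∀ k g, weylEnd n V (d k) * L g = L g * weylEnd n V (d k) + L (MvPolynomial.pderiv k g)) →
    (∀ k g, L g * weylEnd n V (t k) =
      weylEnd n V (t k) * L g + c k • weylEnd n V (ofPoly g)) →
    ∀ v ∈ N, L g v ∈ N := by
  induction g using MvPolynomial.induction_on with
  | C a =>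
    intro L c hd ht v hv
    have hcomm := commute_weylEnd_of_generators (φ := L 1 - ∑ k, c k • weylEnd n V (d k))
      (fun i => by
        rw [Commute, SemiconjBy, sub_mul, mul_sub, ht, Finset.sum_mul, Finset.mul_sum]
        simp only [smul_mul_assoc, mul_smul_comm, ← map_mul, d_mul_t, map_add, smul_add,
          Finset.sum_add_distrib, map_one, apply_ite (weylEnd n V), map_zero, smul_ite, smul_zero,
          Finset.sum_ite_eq', Finset.mem_univ, if_true]
        abel)
      (fun i => by
        rw [Commute, SemiconjBy, sub_mul, mul_sub, hd, Finset.sum_mul, Finset.mul_sum]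
        simp only [smul_mul_assoc, mul_smul_comm, ← map_mul, d_mul_d i, Derivation.map_one_eq_zero,
          map_zero, add_zero])
    have e : L (MvPolynomial.C a) v =
        a • ((L 1 - ∑ k, c k • weylEnd n V (d k)) v + ∑ k, c k • (d k : WeylAlg n) • v) := by
      rw [show (MvPolynomial.C a : PolyAlg n) = a • 1 by
        rw [← MvPolynomial.C_mul', mul_one], map_smul]
      simp [weylEnd_apply, LinearMap.sum_apply]
    rw [e]
    exact N.smul_mem a (N.add_mem (hC _ hcomm v hv)
      (N.sum_mem fun k _ => N.smul_mem _ (hK _ _ hv)))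
  | add p q hp hq =>
    intro L c hd ht v hv
    rw [map_add]
    exact N.add_mem (hp L c hd ht v hv) (hq L c hd ht v hv)
  | mul_X p i hp =>
    intro L c hd ht v hv
    let L' : PolyAlg n →ₗ[ℂ] Module.End ℂ V :=
      L ∘ₗ LinearMap.mulRight ℂ (MvPolynomial.X i) - LinearMap.mulLeft ℂ (weylEnd n V (t i)) ∘ₗ L
    have hL' : ∀ g, L' g = L (g * MvPolynomial.X i) - weylEnd n V (t i) * L g := fun g => rfl
    have h := hp L' 0
      (fun k g => by
        have e : weylEnd n V (d k) * weylEnd n V (t i) =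
            weylEnd n V (t i) * weylEnd n V (d k) + if k = i then 1 else 0 := by
          rw [← map_mul, d_mul_t, map_add, map_mul, apply_ite (weylEnd n V), map_one, map_zero]
        rw [hL', hL', mul_sub, sub_mul, hd, ← mul_assoc, e, add_mul, mul_assoc _ _ (L g), hd,
          Derivation.leibniz, map_add, MvPolynomial.pderiv_X, Pi.single_apply]
        by_cases hk : k = i
        · subst hk
          simp only [if_true, smul_eq_mul, mul_one, one_mul, mul_add, mul_comm (MvPolynomial.X k),
            mul_assoc]
          abel
        · rw [if_neg hk, if_neg (Ne.symm hk)]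
          simp only [smul_eq_mul, mul_zero, map_zero, zero_mul, mul_add, mul_assoc,
            mul_comm (MvPolynomial.X i)]
          abel)
      (fun k g => by
        have e : weylEnd n V (t i) * weylEnd n V (t k) =
            weylEnd n V (t k) * weylEnd n V (t i) := by
          rw [← map_mul, t_mul_t, map_mul]
        have e' : weylEnd n V (ofPoly (g * MvPolynomial.X i)) =
            weylEnd n V (t i) * weylEnd n V (ofPoly g) := by
          rw [mul_comm, map_mul, map_mul, ofPoly_X]
        rw [hL', sub_mul, mul_sub, ht, mul_assoc, ht, e', mul_add, ← mul_assoc, e,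
          mul_smul_comm, Pi.zero_apply, zero_smul, mul_assoc]
        abel) v hv
    have e : L (p * MvPolynomial.X i) v = (t i : WeylAlg n) • L p v + L' p v := by
      rw [hL']
      simp [weylEnd_apply]
    rw [e]
    exact N.add_mem (hK _ _ (hp L c hd ht v hv)) h

theorem IsWeylCompatible.wittEnd_mem_of_commutant (h : IsWeylCompatible n V) {N : Submodule ℂ V}
    (hK : ∀ (x : WeylAlg n), ∀ v ∈ N, x • v ∈ N)
    (hC : ∀ φ : Module.End ℂ V, (∀ x : WeylAlg n, Commute φ (weylEnd n V x)) → ∀ v ∈ N, φ v ∈ N)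
    (D : WittPlus n) (v : V) (hv : v ∈ N) : wittEnd n V D v ∈ N := by
  rw [derivation_eq_sum D, map_sum, LinearMap.sum_apply]
  refine N.sum_mem fun j _ => ?_
  let L : PolyAlg n →ₗ[ℂ] Module.End ℂ V :=
    (wittEnd n V : WittPlus n →ₗ[ℂ] Module.End ℂ V) ∘ₗ
      (LinearMap.toSpanSingleton (PolyAlg n) (WittPlus n) (MvPolynomial.pderiv j)).restrictScalars ℂ
  have hL : ∀ g, L g = wittEnd n V (g • (MvPolynomial.pderiv j : WittPlus n)) := fun g => rfl
  refine apply_mem_of_commutant hK hC (D (MvPolynomial.X j)) L (Pi.single j 1)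
    (fun k g => ?_) (fun k g => ?_) v hv
  · rw [hL, hL, h.d_mul_wittEnd, lie_smul_pderiv]
  · rw [hL, ← ofPoly_X, h.wittEnd_mul_ofPoly, Derivation.smul_apply, MvPolynomial.pderiv_X,
      Pi.single_apply]
    by_cases hk : k = j
    · subst hk; simp
    · rw [if_neg hk, Pi.single_eq_of_ne hk]; simp

theorem IsWeylCompatible.eq_top_of_invariant (h : IsWeylCompatible n V)
    (hV : LieModule.IsIrreducible ℂ (ExtWitt n) V) {N : Submodule ℂ V} (hN : N ≠ ⊥)
    (hK : ∀ (x : WeylAlg n), ∀ v ∈ N, x • v ∈ N)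
    (hW : ∀ (D : WittPlus n), ∀ v ∈ N, wittEnd n V D v ∈ N) : N = ⊤ := by
  let N' : LieSubmodule ℂ (ExtWitt n) V :=
    { N with
      lie_mem := fun {x v} hv => by
        change ⁅x, v⁆ ∈ N
        rw [lie_eq_add, ← h.ofPoly_smul]
        exact N.add_mem (hK _ _ hv) (hW _ _ hv) }
  have hN' : N' = ⊤ := (hV.eq_bot_or_eq_top N').resolve_left fun h0 =>
    hN ((LieSubmodule.toSubmodule_eq_bot N').2 h0)
  exact (LieSubmodule.toSubmodule_eq_top (N := N')).2 hN'

end Action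

/-! ### The multiplicity space of a simple weight module -/

section Evaluation

set_option linter.unusedSectionVars false

variable {n : ℕ} {P V : Type*} [AddCommGroup P] [Module ℂ P] [Module (WeylAlg n) P]
  [IsScalarTower ℂ (WeylAlg n) P] [AddCommGroup V] [Module ℂ V] [Module (WeylAlg n) V]
  [IsScalarTower ℂ (WeylAlg n) V]

variable (n P V) in
/-- The evaluation map `p ⊗ f ↦ f p`. -/
noncomputable def evalTensor : P ⊗[ℂ] (P →ₗ[WeylAlg n] V) →ₗ[ℂ] V :=
  TensorProduct.lift (LinearMap.mk₂ ℂ (fun (p : P) (f : P →ₗ[WeylAlg n] V) => f p)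
    (fun p q f => map_add f p q) (fun c p f => f.map_smul_of_tower c p) (fun _ _ _ => rfl)
    (fun _ _ _ => rfl))

theorem evalTensor_tmul (p : P) (f : P →ₗ[WeylAlg n] V) : evalTensor n P V (p ⊗ₜ f) = f p := rfl

theorem evalTensor_weylOp (x : WeylAlg n) (u : P ⊗[ℂ] (P →ₗ[WeylAlg n] V)) :
    evalTensor n P V (LinearMap.rTensor _ (Algebra.lsmul ℂ ℂ P x) u) = x • evalTensor n P V u := by
  induction u using TensorProduct.induction_on with
  | zero => simp
  | tmul p f => simp [evalTensor_tmul]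
  | add u w hu hw => rw [map_add, map_add, map_add, smul_add, hu, hw]

/-- Composition with an operator on `V` that commutes with the Weyl algebra. -/
def postcomp (φ : Module.End ℂ V) (hφ : ∀ x : WeylAlg n, Commute φ (weylEnd n V x)) :
    Module.End ℂ (P →ₗ[WeylAlg n] V) where
  toFun f :=
    { (φ : V →+ V).comp f.toAddMonoidHom with
      map_smul' := fun x p => by
        change φ (f (x • p)) = x • φ (f p)
        rw [map_smul]
        exact LinearMap.congr_fun (hφ x) (f p) }
  map_add' _ _ := LinearMap.ext fun _ => map_add φ _ _
  map_smul' c _ := LinearMap.ext fun _ => map_smul φ c _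

theorem postcomp_apply (φ : Module.End ℂ V) (hφ : ∀ x : WeylAlg n, Commute φ (weylEnd n V x))
    (f : P →ₗ[WeylAlg n] V) (p : P) : postcomp φ hφ f p = φ (f p) := rfl

theorem evalTensor_lTensor (φ : Module.End ℂ V) (hφ : ∀ x : WeylAlg n, Commute φ (weylEnd n V x))
    (u : P ⊗[ℂ] (P →ₗ[WeylAlg n] V)) :
    evalTensor n P V (LinearMap.lTensor P (postcomp φ hφ) u) = φ (evalTensor n P V u) := by
  induction u using TensorProduct.induction_on with
  | zero => simp
  | tmul p f => rfl
  | add u w hu hw => rw [map_add, map_add, map_add, map_add, hu, hw]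

variable {p₀ : P} {lam : Fin n → ℂ}

theorem hom_ext_vacuum (htop : Submodule.span (WeylAlg n) {p₀} = ⊤) {f g : P →ₗ[WeylAlg n] V}
    (h : f p₀ = g p₀) : f = g :=
  LinearMap.ext_on_range (v := fun _ : Unit => p₀) (by simpa using htop) fun _ => h

theorem hom_eq_zero_of_apply_ladders (hv : ∀ i, IsVacuum (t i : WeylAlg n) (d i) (lam i) p₀)
    (htop : Submodule.span (WeylAlg n) {p₀} = ⊤) {f : P →ₗ[WeylAlg n] V} (k : Fin n → ℤ)
    (hk : (ladders k : WeylAlg n) • p₀ ≠ 0) (hf : f ((ladders k : WeylAlg n) • p₀) = 0) :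
    f = 0 := by
  obtain ⟨x, hx⟩ := exists_smul_ladders_eq hv k hk
  have h0 : f p₀ = 0 := by rw [← hx, map_smul, hf, smul_zero]
  exact hom_ext_vacuum htop (by rw [h0, LinearMap.zero_apply])

theorem iSup_range_mk_ladders (hv : ∀ i, IsVacuum (t i : WeylAlg n) (d i) (lam i) p₀)
    (htop : Submodule.span (WeylAlg n) {p₀} = ⊤) (M : Type*) [AddCommGroup M] [Module ℂ M] :
    ⨆ k : Fin n → ℤ, LinearMap.range (TensorProduct.mk ℂ P M ((ladders k : WeylAlg n) • p₀)) =
      ⊤ := by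
  rw [eq_top_iff, ← TensorProduct.span_tmul_eq_top, Submodule.span_le]
  rintro _ ⟨p, m, rfl⟩
  have hp : p ∈ ⨆ k : Fin n → ℤ, ℂ ∙ ((ladders k : WeylAlg n) • p₀) := by
    rw [iSup_span_ladders_eq_top hv htop]; trivial
  induction hp using Submodule.iSup_induction' with
  | mem k p hp =>
    obtain ⟨c, rfl⟩ := Submodule.mem_span_singleton.1 hp
    exact Submodule.mem_iSup_of_mem k ⟨c • m, by
      rw [TensorProduct.mk_apply, TensorProduct.tmul_smul, TensorProduct.smul_tmul']⟩
  | zero => rw [TensorProduct.zero_tmul]; exact Submodule.zero_mem _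
  | add p q _ _ hp hq => rw [TensorProduct.add_tmul]; exact Submodule.add_mem _ hp hq

/-- The weight spaces of `P` are spanned by the vectors `ladders k • p₀`, so an element of the
kernel has components `(ladders k • p₀) ⊗ f`, which again lie in the kernel. -/
theorem evalTensor_injective (hv : ∀ i, IsVacuum (t i : WeylAlg n) (d i) (lam i) p₀)
    (htop : Submodule.span (WeylAlg n) {p₀} = ⊤) :
    Function.Injective (evalTensor n P V) := by
  rw [← LinearMap.ker_eq_bot, eq_bot_iff]
  have h := le_iSup_inf_of_invariant (N := LinearMap.ker (evalTensor n P V))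
    (d := fun i => LinearMap.rTensor (P →ₗ[WeylAlg n] V) (weylEulerOp n P i))
    (fun i w hw => by
      rw [LinearMap.mem_ker] at hw ⊢
      rw [weylEulerOp, evalTensor_weylOp, hw, smul_zero])
    (weights_injective lam)
    (U := fun k => LinearMap.range (TensorProduct.mk ℂ P (P →ₗ[WeylAlg n] V)
      ((ladders k : WeylAlg n) • p₀)))
    (by
      rintro k _ ⟨f, rfl⟩ i
      rw [TensorProduct.mk_apply, LinearMap.rTensor_tmul, ladders_smul_mem_weightSpace hv k i,
        TensorProduct.smul_tmul'])
    (by rw [iSup_range_mk_ladders hv htop]; exact le_top)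
  refine h.trans (iSup_le ?_)
  rintro k _ ⟨⟨f, rfl⟩, hf⟩
  rw [SetLike.mem_coe, LinearMap.mem_ker, TensorProduct.mk_apply, evalTensor_tmul] at hf
  rw [TensorProduct.mk_apply, Submodule.mem_bot]
  by_cases hk : (ladders k : WeylAlg n) • p₀ = 0
  · rw [hk, TensorProduct.zero_tmul]
  · rw [hom_eq_zero_of_apply_ladders hv htop k hk hf, TensorProduct.tmul_zero]

theorem exists_hom_apply_eq (hv : ∀ i, IsVacuum (t i : WeylAlg n) (d i) (lam i) p₀)
    (htop : Submodule.span (WeylAlg n) {p₀} = ⊤) (hsurj : Function.Surjective (evalTensor n P V))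
    {w : V} (hw : w ∈ weightSpace (weylEulerOp n V) lam) :
    ∃ f : P →ₗ[WeylAlg n] V, f p₀ = w := by
  have hrange : ⨆ k : Fin n → ℤ, (LinearMap.range (TensorProduct.mk ℂ P (P →ₗ[WeylAlg n] V)
      ((ladders k : WeylAlg n) • p₀))).map (evalTensor n P V) = ⊤ := by
    rw [← Submodule.map_iSup, iSup_range_mk_ladders hv htop, Submodule.map_top,
      LinearMap.range_eq_top.2 hsurj]
  have hU : ∀ k : Fin n → ℤ, (LinearMap.range (TensorProduct.mk ℂ P (P →ₗ[WeylAlg n] V)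
      ((ladders k : WeylAlg n) • p₀))).map (evalTensor n P V) ≤
        weightSpace (weylEulerOp n V) fun i => lam i + k i := by
    rintro k _ ⟨_, ⟨f, rfl⟩, rfl⟩ i
    rw [TensorProduct.mk_apply, evalTensor_tmul, weylEulerOp_apply, ← map_smul,
      ← weylEulerOp_apply, ladders_smul_mem_weightSpace hv k i, f.map_smul_of_tower]
  have h := le_iSup_inf_of_invariant (N := weightSpace (weylEulerOp n V) lam)
    (fun i v hv => by rw [hv i]; exact Submodule.smul_mem _ _ hv)
    (weights_injective lam) hU (by rw [hrange]; exact le_top)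
  have h0 : ⨆ k : Fin n → ℤ, (LinearMap.range (TensorProduct.mk ℂ P (P →ₗ[WeylAlg n] V)
      ((ladders k : WeylAlg n) • p₀))).map (evalTensor n P V) ⊓
        weightSpace (weylEulerOp n V) lam ≤ (LinearMap.range (TensorProduct.mk ℂ P
          (P →ₗ[WeylAlg n] V) p₀)).map (evalTensor n P V) := by
    refine iSup_le fun k => ?_
    rintro x ⟨hx, hx'⟩
    by_cases hx0 : x = 0
    · rw [hx0]; exact Submodule.zero_mem _
    · obtain rfl : k = 0 := weights_injective lam
        ((eq_of_mem_weightSpace hx0 (hU k hx) hx').trans (by simp))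
      rwa [ladders_zero, one_smul] at hx
  obtain ⟨_, ⟨f, rfl⟩, hf⟩ := h0 (h hw)
  exact ⟨f, hf⟩

theorem IsWeylCompatible.evalTensor_surjective [LieRingModule (ExtWitt n) V]
    [LieModule ℂ (ExtWitt n) V] (h : IsWeylCompatible n V)
    (hV : LieModule.IsIrreducible ℂ (ExtWitt n) V) {f : P →ₗ[WeylAlg n] V} (hf : f ≠ 0) :
    Function.Surjective (evalTensor n P V) := by
  rw [← LinearMap.range_eq_top]
  have hK : ∀ (x : WeylAlg n), ∀ v ∈ LinearMap.range (evalTensor n P V),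
      x • v ∈ LinearMap.range (evalTensor n P V) := by
    rintro x _ ⟨u, rfl⟩
    exact ⟨_, evalTensor_weylOp x u⟩
  refine h.eq_top_of_invariant hV (fun h0 => hf ?_) hK (h.wittEnd_mem_of_commutant hK ?_)
  · ext p
    exact (Submodule.mem_bot ℂ).1 (h0 ▸ ⟨p ⊗ₜ f, rfl⟩)
  · rintro φ hφ _ ⟨u, rfl⟩
    exact ⟨_, evalTensor_lTensor φ hφ u⟩

end Evaluation

/-! ### The action of `𝔤𝔩_n` commuting with the Weyl algebra -/

/-- The linear vector field `∑ B_{ij} t_i ∂_j`. -/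
noncomputable def linField (n : ℕ) : GL_Lie n →ₗ⁅ℂ⁆ WittPlus n where
  toFun B := MvPolynomial.mkDerivation ℂ fun j => ∑ i, B i j • MvPolynomial.X i
  map_add' B C := by
    apply MvPolynomial.derivation_ext
    intro j
    simp [MvPolynomial.mkDerivation_X, add_smul, Finset.sum_add_distrib]
  map_smul' c B := by
    apply MvPolynomial.derivation_ext
    intro j
    simp [MvPolynomial.mkDerivation_X, mul_smul, Finset.smul_sum]
  map_lie' {B C} := by
    apply MvPolynomial.derivation_ext
    intro j
    rw [Derivation.commutator_apply, LieRing.of_associative_ring_bracket]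
    simp only [MvPolynomial.mkDerivation_X, map_sum, Derivation.map_smul, Matrix.sub_apply,
      sub_smul, Finset.sum_sub_distrib, Matrix.mul_apply, Finset.sum_smul, Finset.smul_sum,
      smul_smul]
    congr 1
    · rw [Finset.sum_comm]
      exact Finset.sum_congr rfl fun i _ => Finset.sum_congr rfl fun k _ => by rw [mul_comm]
    · rw [Finset.sum_comm]
      exact Finset.sum_congr rfl fun i _ => Finset.sum_congr rfl fun k _ => by rw [mul_comm]

theorem linField_X {n : ℕ} (B : GL_Lie n) (j : Fin n) :
    linField n B (MvPolynomial.X j) = ∑ i, B i j • MvPolynomial.X i :=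
  MvPolynomial.mkDerivation_X ..

theorem linField_single {n : ℕ} (i j : Fin n) :
    linField n (Matrix.single i j 1) =
      (MvPolynomial.X i : PolyAlg n) • (MvPolynomial.pderiv j : WittPlus n) := by
  apply MvPolynomial.derivation_ext
  intro k
  rw [linField_X, Derivation.smul_apply, MvPolynomial.pderiv_X, Finset.sum_eq_single i]
  · by_cases h : j = k
    · subst h; simp
    · rw [Matrix.single_apply_of_ne _ _ _ _ _ (by simp [h]), Pi.single_eq_of_ne (Ne.symm h)]
      simp
  · intro l _ hl
    rw [Matrix.single_apply_of_ne _ _ _ _ _ (by simp [Ne.symm hl]), zero_smul]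
  · simp

theorem pderiv_lie_linField {n : ℕ} (k : Fin n) (B : GL_Lie n) :
    ⁅(MvPolynomial.pderiv k : WittPlus n), linField n B⁆ =
      ∑ j, B k j • (MvPolynomial.pderiv j : WittPlus n) := by
  apply MvPolynomial.derivation_ext
  intro i
  have h : linField n B (MvPolynomial.pderiv k (MvPolynomial.X i : PolyAlg n)) = 0 := by
    rw [MvPolynomial.pderiv_X, Pi.single_apply]
    split_ifs <;> simp
  rw [Derivation.commutator_apply, linField_X, derivation_sum_apply, h, sub_zero]
  simp [MvPolynomial.pderiv_X, Pi.single_apply, Finset.sum_ite_eq, smul_ite]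

section Action

set_option linter.unusedSectionVars false

variable {n : ℕ} {V : Type*} [AddCommGroup V] [Module ℂ V] [LieRingModule (ExtWitt n) V]
  [LieModule ℂ (ExtWitt n) V] [Module (WeylAlg n) V] [IsScalarTower ℂ (WeylAlg n) V]

variable (n V) in
/-- The difference between the actions of a vector field `D` on `V` in `W_n^+` and in the Weyl
algebra. -/
noncomputable def wittDiff : WittPlus n →ₗ[ℂ] Module.End ℂ V :=
  (wittEnd n V : WittPlus n →ₗ[ℂ] Module.End ℂ V) - (weylEnd n V).toLinearMap ∘ₗ ofWitt

theorem wittDiff_apply (D : WittPlus n) :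
    wittDiff n V D = wittEnd n V D - weylEnd n V (ofWitt D) := rfl

theorem IsWeylCompatible.commute_wittDiff_ofPoly (h : IsWeylCompatible n V) (D : WittPlus n)
    (f : PolyAlg n) :
    Commute (wittDiff n V D) (weylEnd n V (ofPoly f)) := by
  rw [Commute, SemiconjBy, wittDiff_apply, sub_mul, h.wittEnd_mul_ofPoly, ← map_mul,
    ofWitt_mul_ofPoly, map_add, map_mul, mul_sub]
  abel

theorem IsWeylCompatible.wittDiff_pderiv (h : IsWeylCompatible n V) (i : Fin n) :
    wittDiff n V (MvPolynomial.pderiv i) = 0 := by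
  rw [wittDiff_apply, h.wittEnd_pderiv, ofWitt_pderiv, sub_self]

theorem IsWeylCompatible.d_mul_wittDiff (h : IsWeylCompatible n V) (i : Fin n) (D : WittPlus n) :
    weylEnd n V (d i) * wittDiff n V D = wittDiff n V D * weylEnd n V (d i) +
      wittDiff n V ⁅(MvPolynomial.pderiv i : WittPlus n), D⁆ := by
  rw [wittDiff_apply, wittDiff_apply, mul_sub, h.d_mul_wittEnd, ofWitt_lie, ofWitt_pderiv, map_sub,
    map_mul, map_mul, sub_mul]
  abel

theorem IsWeylCompatible.commute_wittDiff_linField (h : IsWeylCompatible n V) (B : GL_Lie n)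
    (x : WeylAlg n) :
    Commute (wittDiff n V (linField n B)) (weylEnd n V x) := by
  refine commute_weylEnd_of_generators (fun i => ?_) (fun i => ?_) x
  · rw [← ofPoly_X]
    exact h.commute_wittDiff_ofPoly _ _
  · have e := h.d_mul_wittDiff i (linField n B)
    rw [pderiv_lie_linField, map_sum, Finset.sum_eq_zero, add_zero] at e
    · exact e.symm
    · intro j _
      rw [map_smul, h.wittDiff_pderiv, smul_zero]

/-- The representation of `𝔤𝔩_n` on `V` by the operators `t_i ∂_j - t_i · ∂_j`, where `t_i ∂_j` acts
as an element of `W_n^+`, and `t_i · ∂_j` as an element of the Weyl algebra. -/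
noncomputable def glEnd (h : IsWeylCompatible n V) : GL_Lie n →ₗ⁅ℂ⁆ Module.End ℂ V :=
  { wittDiff n V ∘ₗ (linField n : GL_Lie n →ₗ[ℂ] WittPlus n) with
    map_lie' := fun {B C} => by
      change wittDiff n V (linField n ⁅B, C⁆) =
        ⁅wittDiff n V (linField n B), wittDiff n V (linField n C)⁆
      have h1 : wittDiff n V (linField n B) * wittDiff n V (linField n C) -
          wittDiff n V (linField n C) * wittDiff n V (linField n B) =
          wittDiff n V (linField n B) * wittEnd n V (linField n C) -
            wittEnd n V (linField n C) * wittDiff n V (linField n B) := by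
        rw [wittDiff_apply (linField n C), mul_sub, sub_mul,
          (h.commute_wittDiff_linField B _).eq]
        abel
      have h2 : weylEnd n V (ofWitt (linField n B)) * wittEnd n V (linField n C) -
          wittEnd n V (linField n C) * weylEnd n V (ofWitt (linField n B)) =
          weylEnd n V (ofWitt (linField n B)) * weylEnd n V (ofWitt (linField n C)) -
            weylEnd n V (ofWitt (linField n C)) * weylEnd n V (ofWitt (linField n B)) := by
        have e := (h.commute_wittDiff_linField C (ofWitt (linField n B))).eq
        rw [wittDiff_apply, sub_mul, mul_sub] at e
        rw [← sub_eq_zero] at e ⊢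
        rw [← neg_eq_zero, ← e]
        abel
      rw [LieRing.of_associative_ring_bracket (wittDiff n V (linField n B)), h1, wittDiff_apply,
        wittDiff_apply, sub_mul, mul_sub, LieHom.map_lie (linField n), wittEnd_lie, ofWitt_lie,
        map_sub, map_mul, map_mul, ← h2]
      abel }

theorem glEnd_apply (h : IsWeylCompatible n V) (B : GL_Lie n) :
    glEnd h B = wittEnd n V (linField n B) - weylEnd n V (ofWitt (linField n B)) := rfl

theorem commute_glEnd (h : IsWeylCompatible n V) (B : GL_Lie n) (x : WeylAlg n) :
    Commute (glEnd h B) (weylEnd n V x) :=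
  h.commute_wittDiff_linField B x

theorem glEnd_smul (h : IsWeylCompatible n V) (B : GL_Lie n) (x : WeylAlg n) (v : V) :
    glEnd h B (x • v) = x • glEnd h B v :=
  LinearMap.congr_fun (commute_glEnd h B x) v

theorem WeylAlg.ofWitt_smul_pderiv (g : PolyAlg n) (j : Fin n) :
    ofWitt (g • (MvPolynomial.pderiv j : WittPlus n)) = ofPoly g * d j := by
  simp [ofWitt, MvPolynomial.pderiv_X, Pi.single_apply, apply_ite (ofPoly (n := n)), ite_mul]

theorem eulerOp_eq (h : IsWeylCompatible n V) (i : Fin n) :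
    eulerOp n V i = weylEulerOp n V i + glEnd h (Matrix.single i i 1) := by
  rw [glEnd_apply, linField_single, ofWitt_smul_pderiv, ofPoly_X]
  exact (add_sub_cancel _ _).symm

variable (P : Type*) [AddCommGroup P] [Module ℂ P] [Module (WeylAlg n) P]
  [IsScalarTower ℂ (WeylAlg n) P]

/-- The representation of `𝔤𝔩_n` on the multiplicity space of `P` in `V`. -/
noncomputable def glHom (h : IsWeylCompatible n V) :
    GL_Lie n →ₗ⁅ℂ⁆ Module.End ℂ (P →ₗ[WeylAlg n] V) where
  toFun B := postcomp (glEnd h B) (commute_glEnd h B)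
  map_add' B C := by
    ext f p
    simp only [LinearMap.add_apply, postcomp_apply, map_add]
  map_smul' c B := by
    ext f p
    simp only [LinearMap.smul_apply, postcomp_apply, map_smul, RingHom.id_apply]
  map_lie' {B C} := by
    ext f p
    rw [postcomp_apply, LieHom.map_lie, LieRing.of_associative_ring_bracket (glEnd h B),
      LieRing.of_associative_ring_bracket (postcomp (glEnd h B) _)]
    rfl

variable {P}

theorem glHom_apply (h : IsWeylCompatible n V) (B : GL_Lie n) (f : P →ₗ[WeylAlg n] V) (p : P) :
    glHom P h B f p = glEnd h B (f p) := rfl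

theorem evalTensor_glHom (h : IsWeylCompatible n V) (B : GL_Lie n)
    (u : P ⊗[ℂ] (P →ₗ[WeylAlg n] V)) :
    evalTensor n P V (LinearMap.lTensor P (glHom P h B) u) = glEnd h B (evalTensor n P V u) :=
  evalTensor_lTensor _ (commute_glEnd h B) u

end Action

/-! ### Weights and finite-dimensionality of the multiplicity space -/

theorem linearIndependent_tmul_of_ne_zero {ι P M : Type*} [AddCommGroup P] [Module ℂ P]
    [AddCommGroup M] [Module ℂ M] {f : ι → M} (hf : LinearIndependent ℂ f) {p : ι → P}
    (hp : ∀ i, p i ≠ 0) : LinearIndependent ℂ fun i => p i ⊗ₜ[ℂ] f i := by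
  classical
  obtain ⟨g, hg⟩ := LinearMap.exists_leftInverse_of_injective
    (Finsupp.linearCombination ℂ f) (LinearMap.ker_eq_bot.2 hf)
  have hgf : ∀ i, g (f i) = Finsupp.single i 1 := fun i => by
    have := LinearMap.congr_fun hg (Finsupp.single i 1)
    simpa using this
  rw [linearIndependent_iff']
  intro s c hc i hi
  have h := congrArg (TensorProduct.rid ℂ P)
    (congrArg (LinearMap.lTensor P (Finsupp.lapply i ∘ₗ g)) hc)
  rw [map_sum, map_sum, Finset.sum_eq_single i] at h
  · simpa [hgf, hp i] using h
  · intro j _ hj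
    simp [hgf, hj]
  · intro h'; exact absurd hi h'

theorem eulerField_lie_monomial {n : ℕ} (i j : Fin n) (s : Fin n →₀ ℕ) (a : ℂ) :
    ⁅(eulerField i : WittPlus n),
      MvPolynomial.monomial s a • (MvPolynomial.pderiv j : WittPlus n)⁆ =
      ((s i : ℂ) - if i = j then 1 else 0) •
        (MvPolynomial.monomial s a • (MvPolynomial.pderiv j : WittPlus n)) := by
  apply MvPolynomial.derivation_ext
  intro k
  have h : eulerField i (MvPolynomial.monomial s a) = (s i : ℂ) • MvPolynomial.monomial s a := by
    rw [eulerField, Derivation.smul_apply, smul_eq_mul, MvPolynomial.X_mul_pderiv_monomial,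
      Nat.cast_smul_eq_nsmul]
  have hj : eulerField i (MvPolynomial.pderiv j (MvPolynomial.X k : PolyAlg n)) = 0 := by
    rw [MvPolynomial.pderiv_X, Pi.single_apply]
    split_ifs <;> simp
  have hE : MvPolynomial.pderiv j (eulerField i (MvPolynomial.X k : PolyAlg n)) =
      (if i = j then 1 else 0 : ℂ) • MvPolynomial.pderiv j (MvPolynomial.X k : PolyAlg n) := by
    rw [eulerField, Derivation.smul_apply, smul_eq_mul, MvPolynomial.pderiv_X]
    by_cases hk : i = k
    · subst hk
      by_cases hi : i = j
      · subst hi; simp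
      · simp [hi]
    · by_cases hi : i = j
      · subst hi; simp [Ne.symm hk]
      · simp [hi, Ne.symm hk]
  rw [Derivation.commutator_apply]
  simp only [Derivation.smul_apply, smul_eq_mul, Derivation.leibniz, h, hj, hE, sub_smul]
  simp only [mul_zero, zero_add, mul_smul_comm]
  simp only [mul_comm]

section Action

set_option linter.unusedSectionVars false

variable {n : ℕ} {V : Type*} [AddCommGroup V] [Module ℂ V] [LieRingModule (ExtWitt n) V]
  [LieModule ℂ (ExtWitt n) V] [Module (WeylAlg n) V] [IsScalarTower ℂ (WeylAlg n) V]

theorem eulerOp_eq_wittEnd (i : Fin n) : eulerOp n V i = wittEnd n V (eulerField i) := rfl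

theorem wittEnd_monomial_mem (j : Fin n) (s : Fin n →₀ ℕ) (a : ℂ) {α : Fin n → ℂ} {v : V}
    (hv : v ∈ weightSpace (eulerOp n V) α) :
    wittEnd n V (MvPolynomial.monomial s a • (MvPolynomial.pderiv j : WittPlus n)) v ∈
      weightSpace (eulerOp n V) fun i => α i + ((s i : ℂ) - if i = j then 1 else 0) := by
  intro i
  have h := LinearMap.congr_fun (wittEnd_lie (V := V) (eulerField i)
    (MvPolynomial.monomial s a • (MvPolynomial.pderiv j : WittPlus n))) v
  rw [eulerField_lie_monomial, map_smul (wittEnd n V) ((s i : ℂ) - _), LinearMap.sub_apply,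
    Module.End.mul_apply,
    Module.End.mul_apply, ← eulerOp_eq_wittEnd, hv i, LinearMap.map_smul, LinearMap.smul_apply] at h
  rw [add_smul, h]
  abel

theorem IsWeylCompatible.t_smul_mem (h : IsWeylCompatible n V) (j : Fin n) {α : Fin n → ℂ} {v : V}
    (hv : v ∈ weightSpace (eulerOp n V) α) :
    (t j : WeylAlg n) • v ∈ weightSpace (eulerOp n V) fun i => α i + if i = j then 1 else 0 := by
  intro i
  have e := LinearMap.congr_fun (h.wittEnd_mul_ofPoly (eulerField i) (MvPolynomial.X j)) v
  rw [Module.End.mul_apply, LinearMap.add_apply, Module.End.mul_apply, ← eulerOp_eq_wittEnd, hv i,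
    map_smul, weylEnd_apply, ofPoly_X, eulerField, Derivation.smul_apply, MvPolynomial.pderiv_X,
    Pi.single_apply] at e
  rw [e, add_smul]
  congr 1
  by_cases hij : i = j
  · subst hij; simp [weylEnd_apply]
  · simp [hij, Ne.symm hij]

/-- The weights of an irreducible module lie in one coset of the integral weights. -/
theorem IsWeylCompatible.exists_weight_eq_add (h : IsWeylCompatible n V)
    (hV : LieModule.IsIrreducible ℂ (ExtWitt n) V) {α β : Fin n → ℂ} {v w : V} (hv : v ≠ 0)
    (hvα : v ∈ weightSpace (eulerOp n V) α) (hw : w ≠ 0) (hwβ : w ∈ weightSpace (eulerOp n V) β) :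
    ∃ k : Fin n → ℤ, β = fun i => α i + k i := by
  have : SMulCommClass ℂ (WeylAlg n) V := IsScalarTower.to_smulCommClass
  let N : Submodule ℂ V := ⨆ k : Fin n → ℤ, weightSpace (eulerOp n V) fun i => α i + k i
  have hmem : ∀ (φ : Module.End ℂ V), (∀ k : Fin n → ℤ, ∃ k' : Fin n → ℤ,
      ∀ x ∈ weightSpace (eulerOp n V) (fun i => α i + k i),
        φ x ∈ weightSpace (eulerOp n V) (fun i => α i + k' i)) → ∀ x ∈ N, φ x ∈ N := by
    intro φ hφ x hx
    induction hx using Submodule.iSup_induction' with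
    | mem k x hx =>
      obtain ⟨k', hk'⟩ := hφ k
      exact Submodule.mem_iSup_of_mem k' (hk' x hx)
    | zero => rw [map_zero]; exact N.zero_mem
    | add x y _ _ hx hy => rw [map_add]; exact N.add_mem hx hy
  have hmono : ∀ (j : Fin n) (s : Fin n →₀ ℕ) (a : ℂ), ∀ x ∈ N,
      wittEnd n V (MvPolynomial.monomial s a • (MvPolynomial.pderiv j : WittPlus n)) x ∈ N := by
    intro j s a
    refine hmem _ fun k => ⟨fun i => k i + (s i - if i = j then 1 else 0), fun x hx => ?_⟩
    convert wittEnd_monomial_mem j s a hx using 2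
    funext i
    push_cast
    ring
  have htop : N = ⊤ := by
    refine h.eq_top_of_invariant hV ?_ ?_ ?_
    · refine (Submodule.ne_bot_iff _).2 ⟨v, Submodule.mem_iSup_of_mem 0 ?_, hv⟩
      simpa using hvα
    · refine smul_mem_of_generators (fun j => ?_) (fun j => ?_)
      · refine hmem (weylEnd n V (t j)) fun k =>
          ⟨fun i => k i + if i = j then 1 else 0, fun x hx => ?_⟩
        rw [weylEnd_apply]
        convert h.t_smul_mem j hx using 2
        funext i
        push_cast
        ring
      · intro x hx
        have e := hmono j 0 1 x hx
        rwa [show (MvPolynomial.monomial 0 1 : PolyAlg n) = 1 from rfl, one_smul,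
          h.wittEnd_pderiv] at e
    · intro D x hx
      rw [derivation_eq_sum D, map_sum, LinearMap.sum_apply]
      refine N.sum_mem fun j _ => ?_
      induction D (MvPolynomial.X j) using MvPolynomial.induction_on' with
      | monomial s a => exact hmono j s a x hx
      | add p q hp hq => rw [add_smul, map_add]; exact N.add_mem hp hq
  have hle := le_iSup_inf_of_invariant (N := weightSpace (eulerOp n V) β)
    (fun i x hx => by rw [hx i]; exact Submodule.smul_mem _ _ hx) (weights_injective α)
    (fun k => le_rfl) (le_top.trans htop.ge)
  by_contra! hne
  have hbot : ⨆ k : Fin n → ℤ, weightSpace (eulerOp n V) (fun i => α i + k i) ⊓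
      weightSpace (eulerOp n V) β = ⊥ := by
    rw [iSup_eq_bot]
    intro k
    rw [eq_bot_iff]
    rintro x ⟨hx, hx'⟩
    by_contra hx0
    exact hne k (eq_of_mem_weightSpace hx0 hx' hx)
  rw [hbot] at hle
  exact hw ((Submodule.mem_bot ℂ).1 (hle hwβ))

variable {P : Type*} [AddCommGroup P] [Module ℂ P] [Module (WeylAlg n) P]
  [IsScalarTower ℂ (WeylAlg n) P] {p₀ : P} {lam : Fin n → ℂ}

theorem apply_mem_weightSpace (h : IsWeylCompatible n V) {μ ν : Fin n → ℂ}
    {f : P →ₗ[WeylAlg n] V} (hf : f ∈ weightSpace (fun i => glHom P h (Matrix.single i i 1)) μ)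
    {p : P} (hp : p ∈ weightSpace (weylEulerOp n P) ν) :
    f p ∈ weightSpace (eulerOp n V) fun i => ν i + μ i := by
  intro i
  rw [eulerOp_eq h, LinearMap.add_apply, weylEulerOp_apply, ← map_smul, ← weylEulerOp_apply, hp i,
    f.map_smul_of_tower, ← glHom_apply h, hf i, LinearMap.smul_apply, add_smul]

theorem iSup_weightSpace_hom_eq_top (h : IsWeylCompatible n V)
    (hv : ∀ i, IsVacuum (t i : WeylAlg n) (d i) (lam i) p₀)
    (htop : Submodule.span (WeylAlg n) {p₀} = ⊤) (hsurj : Function.Surjective (evalTensor n P V))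
    (hweight : IsWeight (eulerOp n V)) :
    ⨆ μ, weightSpace (fun i => glHom P h (Matrix.single i i 1) : Fin n → Module.End ℂ _) μ = ⊤ := by
  rw [eq_top_iff]
  rintro f -
  have hfp : f p₀ ∈ weightSpace (weylEulerOp n V) lam := fun i => by
    rw [weylEulerOp_apply, ← map_smul, (hv i).1, f.map_smul_of_tower]
  have hle := le_iSup_inf_of_invariant (N := weightSpace (weylEulerOp n V) lam)
    (d := eulerOp n V) (ν := id) (U := weightSpace (eulerOp n V))
    (fun i x hx => by
      rw [eulerOp_eq h, LinearMap.add_apply, hx i]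
      refine Submodule.add_mem _ (Submodule.smul_mem _ _ hx) fun j => ?_
      rw [weylEulerOp_apply, ← glEnd_smul, ← weylEulerOp_apply, hx j, map_smul])
    Function.injective_id (fun _ => le_rfl) (by rw [hweight.2]; exact le_top)
  obtain ⟨w, hw, hsum⟩ := (Submodule.mem_iSup_iff_exists_finsupp _ _).1 (hle hfp)
  choose g hg using fun α => exists_hom_apply_eq hv htop hsurj (hw α).2
  have hgμ : ∀ α, g α ∈ weightSpace
      (fun i => glHom P h (Matrix.single i i 1)) (fun i => α i - lam i) := by
    intro α i
    refine hom_ext_vacuum htop ?_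
    have e := (hw α).1 i
    rw [eulerOp_eq h, LinearMap.add_apply, (hw α).2 i] at e
    rw [glHom_apply, LinearMap.smul_apply, hg, sub_smul, ← e]
    abel
  have hf : f = ∑ α ∈ w.support, g α := hom_ext_vacuum htop <| by
    rw [LinearMap.sum_apply, ← hsum]
    exact Finset.sum_congr rfl fun α _ => (hg α).symm
  rw [hf]
  exact Submodule.sum_mem _ fun α _ => Submodule.mem_iSup_of_mem _ (hgμ α)

/-- Finitely many weights of the multiplicity space, all in one coset, can be completed to one and
the same weight of `V` by weights of `P`, since the support of `P` contains an orthant. Hence the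
bound for `V` is a bound for the multiplicity space. -/
theorem finiteDimensional_hom (h : IsWeylCompatible n V)
    (hV : LieModule.IsIrreducible ℂ (ExtWitt n) V)
    (hv : ∀ i, IsVacuum (t i : WeylAlg n) (d i) (lam i) p₀) (hp₀ : p₀ ≠ 0)
    (htop : Submodule.span (WeylAlg n) {p₀} = ⊤) (hsurj : Function.Surjective (evalTensor n P V))
    (hweight : IsWeight (eulerOp n V)) (hbdd : HasBoundedWeightSpaces (eulerOp n V))
    {α₀ : Fin n → ℂ} {v₀ : V} (hv₀ : v₀ ≠ 0) (hα₀ : v₀ ∈ weightSpace (eulerOp n V) α₀) :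
    FiniteDimensional ℂ (P →ₗ[WeylAlg n] V) := by
  obtain ⟨N, hN⟩ := hbdd
  let S : Set (P →ₗ[WeylAlg n] V) :=
    ⋃ μ, weightSpace (fun i => glHom P h (Matrix.single i i 1)) μ
  have hS : Submodule.span ℂ S = ⊤ := by
    rw [← iSup_weightSpace_hom_eq_top h hv htop hsurj hweight, Submodule.iSup_eq_span]
  obtain ⟨b, hbS, hb, hbli⟩ := exists_linearIndependent ℂ S
  rw [hS] at hb
  suffices hfin : b.Finite from Module.finite_def.2 (Submodule.fg_def.2 ⟨b, hfin, hb⟩)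
  by_contra hinf
  obtain ⟨F, hFb, hF⟩ := Set.Infinite.exists_subset_card_eq hinf (N + 1)
  have hFli : LinearIndependent ℂ fun f : F => (f : P →ₗ[WeylAlg n] V) :=
    hbli.comp (fun f : F => ⟨f, hFb f.2⟩) fun f g hfg => Subtype.ext (congrArg (·.1) hfg)
  have hμ : ∀ f : F, ∃ μ, (f : P →ₗ[WeylAlg n] V) ∈
      weightSpace (fun i => glHom P h (Matrix.single i i 1)) μ := fun f =>
    Set.mem_iUnion.1 (hbS (hFb f.2))
  choose μ hμ using hμ
  have hp₀w : p₀ ∈ weightSpace (weylEulerOp n P) lam := fun i => (hv i).1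
  have hz : ∀ f : F, ∃ z : Fin n → ℤ, (fun i => lam i + μ f i) = fun i => α₀ i + z i := fun f =>
    h.exists_weight_eq_add hV hv₀ hα₀
      (fun h0 => hFli.ne_zero f (hom_ext_vacuum htop (by simpa using h0)))
      (apply_mem_weightSpace h (hμ f) hp₀w)
  choose z hz using hz
  obtain ⟨s, hs, hs'⟩ := exists_sign_ladders_smul_ne_zero hv hp₀
  let K : ℤ := ∑ f, ∑ i, |z f i|
  have hK : ∀ f i, |z f i| ≤ K := fun f i =>
    (Finset.single_le_sum (f := fun i => |z f i|) (fun _ _ => abs_nonneg _)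
      (Finset.mem_univ i)).trans
      (Finset.single_le_sum (f := fun f => ∑ i, |z f i|)
        (fun _ _ => Finset.sum_nonneg fun _ _ => abs_nonneg _) (Finset.mem_univ f))
  have hne : ∀ f : F, (ladders (fun i => s i * K - z f i) : WeylAlg n) • p₀ ≠ 0 := by
    intro f
    refine hs' _ fun i => ?_
    have h1 := abs_le.1 (hK f i)
    rcases hs i with h | h <;> rw [h] <;> linarith
  have hmem : ∀ f : F, (f : P →ₗ[WeylAlg n] V)
      ((ladders (fun i => s i * K - z f i) : WeylAlg n) • p₀) ∈
        weightSpace (eulerOp n V) fun i => α₀ i + s i * K := by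
    intro f
    convert apply_mem_weightSpace h (hμ f) (ladders_smul_mem_weightSpace hv _) using 2
    funext i
    have e := congrFun (hz f) i
    push_cast
    linear_combination -e
  have hli : LinearIndependent ℂ fun f : F => (⟨_, hmem f⟩ :
      weightSpace (eulerOp n V) fun i => α₀ i + s i * K) := by
    refine LinearIndependent.of_comp (Submodule.subtype _) ?_
    exact (linearIndependent_tmul_of_ne_zero hFli hne).map' (evalTensor n P V)
      (LinearMap.ker_eq_bot.2 (evalTensor_injective hv htop))
  have hle := hli.cardinal_lift_le_rank.trans (Cardinal.lift_le.2 (hN _))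
  rw [Cardinal.mk_fintype, Fintype.card_coe, hF, Cardinal.lift_natCast, Cardinal.lift_natCast,
    Nat.cast_le] at hle
  omega

end Action

/-! ### Vanishing of the nonlinear vector fields -/

theorem linField_one_apply {n : ℕ} (f : PolyAlg n) :
    linField n 1 f = ∑ i, MvPolynomial.X i * MvPolynomial.pderiv i f := by
  have h : linField n 1 =
      ∑ i, (MvPolynomial.X i : PolyAlg n) • (MvPolynomial.pderiv i : WittPlus n) := by
    apply MvPolynomial.derivation_ext
    intro j
    rw [linField_X, derivation_sum_apply]
    simp [MvPolynomial.pderiv_X, Pi.single_apply, Matrix.one_apply]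
  rw [h, derivation_sum_apply]
  rfl

theorem linField_one_lie_smul_pderiv {n m : ℕ} {g : PolyAlg n} (hg : g.IsHomogeneous m)
    (j : Fin n) : ⁅linField n 1, g • (MvPolynomial.pderiv j : WittPlus n)⁆ =
      ((m : ℂ) - 1) • (g • (MvPolynomial.pderiv j : WittPlus n)) := by
  apply MvPolynomial.derivation_ext
  intro k
  have h0 : linField n 1 (MvPolynomial.pderiv j (MvPolynomial.X k : PolyAlg n)) = 0 := by
    rw [MvPolynomial.pderiv_X, Pi.single_apply]
    split_ifs <;> simp
  have h1 : linField n 1 (MvPolynomial.X k : PolyAlg n) = MvPolynomial.X k := by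
    simp [linField_X, Matrix.one_apply]
  have h2 : linField n 1 g = (m : ℂ) • g := by
    rw [linField_one_apply, hg.sum_X_mul_pderiv, Nat.cast_smul_eq_nsmul]
  rw [Derivation.commutator_apply, Derivation.smul_apply, smul_eq_mul, Derivation.leibniz, h0, h1,
    h2, Derivation.smul_apply, Derivation.smul_apply, sub_smul, one_smul]
  simp only [Derivation.smul_apply, smul_eq_mul, mul_zero, zero_add]
  simp only [mul_comm]
  rw [smul_mul_assoc]

section Action

set_option linter.unusedSectionVars false

variable {n : ℕ} {V : Type*} [AddCommGroup V] [Module ℂ V] [LieRingModule (ExtWitt n) V]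
  [LieModule ℂ (ExtWitt n) V] [Module (WeylAlg n) V] [IsScalarTower ℂ (WeylAlg n) V]

theorem glEnd_one_glEnd (h : IsWeylCompatible n V) (B : GL_Lie n) (v : V) :
    glEnd h 1 (glEnd h B v) = glEnd h B (glEnd h 1 v) := by
  have e : ⁅(1 : GL_Lie n), B⁆ = 0 := by
    rw [LieRing.of_associative_ring_bracket, one_mul, mul_one, sub_self]
  have e' := LinearMap.congr_fun (LieHom.map_lie (glEnd h) 1 B) v
  rw [e, map_zero, LieRing.of_associative_ring_bracket, LinearMap.sub_apply,
    Module.End.mul_apply, Module.End.mul_apply] at e'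
  exact sub_eq_zero.1 e'.symm

theorem glEnd_one_wittEnd (h : IsWeylCompatible n V) (D : WittPlus n) (v : V) :
    glEnd h 1 (wittEnd n V D v) = wittEnd n V D (glEnd h 1 v) +
      wittEnd n V ⁅linField n 1, D⁆ v -
        ∑ i, (t i : WeylAlg n) • wittEnd n V ⁅(MvPolynomial.pderiv i : WittPlus n), D⁆ v +
          (ofWitt D : WeylAlg n) • v := by
  have hE : (ofWitt (linField n 1) : WeylAlg n) = ∑ i : Fin n, t i * d i := by
    change ∑ j, ofPoly (linField n 1 (MvPolynomial.X j)) * d j = _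
    refine Finset.sum_congr rfl fun i _ => ?_
    rw [linField_X]
    simp [Matrix.one_apply]
  have hD : (ofWitt D : WeylAlg n) • v =
      ∑ i, (ofPoly (D (MvPolynomial.X i)) : WeylAlg n) • (d i : WeylAlg n) • v := by
    simp only [← mul_smul]
    rw [← Finset.sum_smul]
    rfl
  have ht : ∀ (i : Fin n) (w : V), wittEnd n V D ((t i : WeylAlg n) • w) =
      (t i : WeylAlg n) • wittEnd n V D w + (ofPoly (D (MvPolynomial.X i)) : WeylAlg n) • w := by
    intro i w
    have := LinearMap.congr_fun (h.wittEnd_mul_ofPoly D (MvPolynomial.X i)) w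
    rwa [ofPoly_X] at this
  have hd : ∀ (i : Fin n) (w : V), (d i : WeylAlg n) • wittEnd n V D w =
      wittEnd n V D ((d i : WeylAlg n) • w) +
        wittEnd n V ⁅(MvPolynomial.pderiv i : WittPlus n), D⁆ w := fun i w =>
    LinearMap.congr_fun (h.d_mul_wittEnd i D) w
  have hw := LinearMap.congr_fun (wittEnd_lie (V := V) (linField n 1) D) v
  rw [LinearMap.sub_apply, Module.End.mul_apply, Module.End.mul_apply] at hw
  rw [glEnd_apply, LinearMap.sub_apply, LinearMap.sub_apply, weylEnd_apply, weylEnd_apply, hE, hw,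
    hD, map_sub, Finset.sum_smul, Finset.sum_smul, map_sum]
  simp only [mul_smul, hd, ht, smul_add, Finset.sum_add_distrib]
  abel

/-- On an eigenspace of the Euler element `1 ∈ 𝔤𝔩_n` which cannot be raised, the vector field
`g ∂_j` acts as in a tensor module. By induction on the degree `m` of `g`, the error is an
eigenvector whose eigenvalue is larger by `m - 1`; hence it vanishes if `m ≥ 2`. -/
theorem wittEnd_smul_pderiv_of_eigenvector (h : IsWeylCompatible n V) {c : ℂ}
    (hmax : ∀ (k : ℕ) (w : V), glEnd h 1 w = (c + (k + 1)) • w → w = 0) (m : ℕ) :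
    ∀ (g : PolyAlg n), g.IsHomogeneous m → ∀ (j : Fin n) (v : V), glEnd h 1 v = c • v →
      wittEnd n V (g • (MvPolynomial.pderiv j : WittPlus n)) v =
        (ofPoly g * d j : WeylAlg n) • v +
          ∑ i, (ofPoly (MvPolynomial.pderiv i g) : WeylAlg n) •
            glEnd h (Matrix.single i j 1) v := by
  have : SMulCommClass ℂ (WeylAlg n) V := IsScalarTower.to_smulCommClass
  have hconst : ∀ g : PolyAlg n, g.IsHomogeneous 0 → ∃ a, g = MvPolynomial.C a := fun g hg =>
    ⟨_, MvPolynomial.totalDegree_eq_zero_iff_eq_C.1 (Nat.le_zero.1 hg.totalDegree_le)⟩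
  have hC : ∀ a : ℂ, (ofPoly (MvPolynomial.C a : PolyAlg n) : WeylAlg n) =
      algebraMap ℂ (WeylAlg n) a := ofPoly.commutes
  induction m using Nat.strong_induction_on with
  | _ m ih =>
  intro g hg j v hv
  match m, ih, hg with
  | 0, _, hg =>
    obtain ⟨a, rfl⟩ := hconst g hg
    have e : (MvPolynomial.C a : PolyAlg n) • (MvPolynomial.pderiv j : WittPlus n) =
        a • (MvPolynomial.pderiv j : WittPlus n) := by
      rw [← algebraMap_smul (PolyAlg n) a]
      rfl
    rw [e, map_smul (wittEnd n V) a, h.wittEnd_pderiv, hC, mul_smul, algebraMap_smul,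
      LinearMap.smul_apply, weylEnd_apply, Finset.sum_eq_zero, add_zero]
    intro i _
    rw [MvPolynomial.pderiv_C, map_zero, zero_smul]
  | 1, _, hg =>
    have hb : ∀ i, ∃ a, MvPolynomial.pderiv i g = MvPolynomial.C a := fun i =>
      hconst _ (hg.pderiv (i := i))
    choose b hb using hb
    have hgsum : g = ∑ i, b i • (MvPolynomial.X i : PolyAlg n) := by
      have e := hg.sum_X_mul_pderiv
      rw [one_smul] at e
      conv_lhs => rw [← e]
      refine Finset.sum_congr rfl fun i _ => ?_
      rw [hb, mul_comm, MvPolynomial.C_mul']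
    have e1 : wittEnd n V (g • (MvPolynomial.pderiv j : WittPlus n)) v =
        ∑ i, b i • wittEnd n V ((MvPolynomial.X i : PolyAlg n) •
          (MvPolynomial.pderiv j : WittPlus n)) v := by
      rw [hgsum, Finset.sum_smul, map_sum, LinearMap.sum_apply]
      refine Finset.sum_congr rfl fun i _ => ?_
      rw [smul_assoc, map_smul (wittEnd n V) (b i), LinearMap.smul_apply]
    have e2 : (ofPoly g * d j : WeylAlg n) • v = ∑ i, b i • (t i * d j : WeylAlg n) • v := by
      rw [hgsum, map_sum, Finset.sum_mul, Finset.sum_smul]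
      refine Finset.sum_congr rfl fun i _ => ?_
      rw [map_smul, ofPoly_X, smul_mul_assoc, smul_assoc]
    rw [e1, e2, ← Finset.sum_add_distrib]
    refine Finset.sum_congr rfl fun i _ => ?_
    rw [hb, hC, algebraMap_smul, glEnd_apply, linField_single, ofWitt_smul_pderiv, ofPoly_X,
      ← smul_add, LinearMap.sub_apply, weylEnd_apply, add_sub_cancel]
  | m + 2, ih, hg =>
    rw [← sub_eq_zero]
    refine hmax m _ ?_
    have hgi : ∀ i, (MvPolynomial.pderiv i g).IsHomogeneous (m + 1) := fun i => hg.pderiv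
    have hcomm : ∀ B : GL_Lie n, glEnd h 1 (glEnd h B v) = c • glEnd h B v := by
      intro B
      rw [glEnd_one_glEnd, hv, map_smul]
    have e1 : ∑ i, (t i : WeylAlg n) • (ofPoly (MvPolynomial.pderiv i g) * d j : WeylAlg n) • v =
        ((m : ℂ) + 2) • (ofPoly g * d j : WeylAlg n) • v := by
      have e := congrArg (fun f => (ofPoly f * d j : WeylAlg n) • v) hg.sum_X_mul_pderiv
      simp only [map_sum, map_mul, ofPoly_X, Finset.sum_mul, Finset.sum_smul, mul_smul,
        map_nsmul, smul_mul_assoc] at e ⊢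
      rw [e, ← Nat.cast_smul_eq_nsmul ℂ, smul_assoc, mul_smul]
      push_cast
      rfl
    have e2 : ∑ i, (t i : WeylAlg n) • ∑ k, (ofPoly (MvPolynomial.pderiv k
        (MvPolynomial.pderiv i g)) : WeylAlg n) • glEnd h (Matrix.single k j 1) v =
        ((m : ℂ) + 1) • ∑ k, (ofPoly (MvPolynomial.pderiv k g) : WeylAlg n) •
          glEnd h (Matrix.single k j 1) v := by
      simp only [Finset.smul_sum]
      rw [Finset.sum_comm]
      refine Finset.sum_congr rfl fun k _ => ?_
      have e := congrArg (fun f => (ofPoly f : WeylAlg n) • glEnd h (Matrix.single k j 1) v)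
        (hgi k).sum_X_mul_pderiv
      simp only [map_sum, map_mul, ofPoly_X, Finset.sum_smul, mul_smul, map_nsmul] at e
      rw [← Nat.cast_smul_eq_nsmul ℂ, smul_assoc] at e
      push_cast at e
      rw [← e]
      refine Finset.sum_congr rfl fun i _ => ?_
      have hpp : MvPolynomial.pderiv k (MvPolynomial.pderiv i g) =
          MvPolynomial.pderiv i (MvPolynomial.pderiv k g) := by
        have := congrArg (fun F : WittPlus n => F g) (pderiv_lie_pderiv k i)
        simp only [Derivation.commutator_apply] at this
        exact sub_eq_zero.1 this
      rw [hpp]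
    rw [map_sub, map_add, glEnd_one_wittEnd, hv, linField_one_lie_smul_pderiv hg, map_sum,
      glEnd_smul, hv, ofWitt_smul_pderiv]
    simp only [lie_smul_pderiv, glEnd_smul, hcomm]
    rw [Finset.sum_congr rfl fun i _ => by
      rw [ih (m + 1) (by omega) _ (hgi i) j v hv, smul_add], Finset.sum_add_distrib, e1, e2,
      map_smul (wittEnd n V), LinearMap.smul_apply]
    simp only [map_smul, smul_comm _ c, ← Finset.smul_sum]
    push_cast
    generalize wittEnd n V (g • (MvPolynomial.pderiv j : WittPlus n)) v = x
    generalize (ofPoly g * d j : WeylAlg n) • v = y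
    generalize ∑ k, (ofPoly (MvPolynomial.pderiv k g) : WeylAlg n) •
          glEnd h (Matrix.single k j 1) v = z
    module

theorem wittEnd_apply_of_eigenvector (h : IsWeylCompatible n V) {c : ℂ}
    (hmax : ∀ (k : ℕ) (w : V), glEnd h 1 w = (c + (k + 1)) • w → w = 0) (D : WittPlus n) {v : V}
    (hv : glEnd h 1 v = c • v) :
    wittEnd n V D v = (ofWitt D : WeylAlg n) • v + ∑ i, ∑ j,
      (ofPoly (MvPolynomial.pderiv i (D (MvPolynomial.X j))) : WeylAlg n) •
        glEnd h (Matrix.single i j 1) v := by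
  have key : ∀ (g : PolyAlg n) (j : Fin n),
      wittEnd n V (g • (MvPolynomial.pderiv j : WittPlus n)) v = (ofPoly g * d j : WeylAlg n) • v +
        ∑ i, (ofPoly (MvPolynomial.pderiv i g) : WeylAlg n) • glEnd h (Matrix.single i j 1) v := by
    intro g j
    induction g using MvPolynomial.induction_on' with
    | monomial s a =>
      exact wittEnd_smul_pderiv_of_eigenvector h hmax _ _
        (MvPolynomial.isHomogeneous_monomial a rfl) j v hv
    | add p q hp hq =>
      rw [add_smul, map_add, LinearMap.add_apply, hp, hq]
      simp only [map_add, add_mul, add_smul, Finset.sum_add_distrib]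
      abel
  have hD : wittEnd n V D v = ∑ j, wittEnd n V
      (D (MvPolynomial.X j) • (MvPolynomial.pderiv j : WittPlus n)) v := by
    conv_lhs => rw [derivation_eq_sum D]
    rw [map_sum, LinearMap.sum_apply]
  rw [hD, Finset.sum_comm, show (ofWitt D : WeylAlg n) =
    ∑ j, ofPoly (D (MvPolynomial.X j)) * d j from rfl, Finset.sum_smul, ← Finset.sum_add_distrib]
  exact Finset.sum_congr rfl fun j _ => key _ j

variable {P : Type*} [AddCommGroup P] [Module ℂ P] [Module (WeylAlg n) P]
  [IsScalarTower ℂ (WeylAlg n) P]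

/-- If the multiplicity space is finite-dimensional, the Euler element has an eigenvalue on it with
maximal real part. The corresponding eigenspace in `V` is a submodule. -/
theorem IsWeylCompatible.wittEnd_apply_eq (h : IsWeylCompatible n V)
    (hV : LieModule.IsIrreducible ℂ (ExtWitt n) V)
    (hbij : Function.Bijective (evalTensor n P V))
    [FiniteDimensional ℂ (P →ₗ[WeylAlg n] V)] [Nontrivial (P →ₗ[WeylAlg n] V)] (D : WittPlus n)
    (v : V) : wittEnd n V D v = (ofWitt D : WeylAlg n) • v + ∑ i, ∑ j,
      (ofPoly (MvPolynomial.pderiv i (D (MvPolynomial.X j))) : WeylAlg n) •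
        glEnd h (Matrix.single i j 1) v := by
  have : SMulCommClass ℂ (WeylAlg n) V := IsScalarTower.to_smulCommClass
  have hfin : {c : ℂ | (glHom P h 1).HasEigenvalue c}.Finite :=
    Module.End.finite_hasEigenvalue (glHom P h 1)
  obtain ⟨c, hc, hcmax⟩ := Set.exists_max_image {c : ℂ | (glHom P h 1).HasEigenvalue c}
    Complex.re hfin
    (Module.End.exists_eigenvalue (glHom P h 1))
  have hmax : ∀ (k : ℕ) (w : V), glEnd h 1 w = (c + (k + 1)) • w → w = 0 := by
    intro k w hw
    obtain ⟨u, rfl⟩ := hbij.2 w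
    have hinj : Function.Injective (glHom P h 1 -
        algebraMap ℂ (Module.End ℂ (P →ₗ[WeylAlg n] V)) (c + (k + 1))) := by
      rw [← LinearMap.ker_eq_bot]
      by_contra hne
      have := hcmax (c + (k + 1)) (by
        rw [Set.mem_ofPred_eq, Module.End.hasEigenvalue_iff, Module.End.eigenspace_def]
        exact hne)
      simp at this
      have : (0 : ℝ) ≤ k := Nat.cast_nonneg k
      linarith
    have h0 : LinearMap.lTensor P (glHom P h 1 -
        algebraMap ℂ (Module.End ℂ (P →ₗ[WeylAlg n] V)) (c + (k + 1))) u = 0 := by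
      apply hbij.1
      rw [LinearMap.lTensor_sub, LinearMap.sub_apply, map_sub, evalTensor_glHom, hw, map_zero,
        sub_eq_zero, Algebra.algebraMap_eq_smul_one, LinearMap.lTensor_smul,
        LinearMap.smul_apply, map_smul]
      congr 2
      exact (LinearMap.congr_fun (LinearMap.lTensor_id P _) u).symm
    rw [Module.Flat.lTensor_preserves_injective_linearMap _ hinj (h0.trans (map_zero _).symm),
      map_zero]
  let N : Submodule ℂ V := Module.End.eigenspace (glEnd h 1) c
  have hN : ∀ w, w ∈ N ↔ glEnd h 1 w = c • w := fun w => Module.End.mem_eigenspace_iff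
  have hK : ∀ (x : WeylAlg n), ∀ w ∈ N, x • w ∈ N := fun x w hw => by
    rw [hN] at hw ⊢
    rw [glEnd_smul, hw, smul_comm]
  have hgl : ∀ (B : GL_Lie n), ∀ w ∈ N, glEnd h B w ∈ N := fun B w hw => by
    rw [hN] at hw ⊢
    rw [glEnd_one_glEnd, hw, map_smul]
  have htop : N = ⊤ := by
    refine h.eq_top_of_invariant hV ?_ hK fun D w hw => ?_
    · obtain ⟨f, hf⟩ := hc.exists_hasEigenvector
      obtain ⟨p, hp⟩ : ∃ p, f p ≠ 0 := by
        by_contra! h0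
        exact hf.2 (LinearMap.ext h0)
      refine (Submodule.ne_bot_iff _).2 ⟨f p, (hN _).2 ?_, hp⟩
      rw [← glHom_apply h, hf.apply_eq_smul, LinearMap.smul_apply]
    · rw [wittEnd_apply_of_eigenvector h hmax D ((hN w).1 hw)]
      exact N.add_mem (hK _ _ hw)
        (N.sum_mem fun i _ => N.sum_mem fun j _ => hK _ _ (hgl _ _ hw))
  exact wittEnd_apply_of_eigenvector h hmax D ((hN v).1 (htop ▸ Submodule.mem_top))

end Action

/-! ### The isomorphism with a tensor module -/

section WeylModule

variable {n : ℕ} {V : Type*} [AddCommGroup V] [Module ℂ V] [LieRingModule (ExtWitt n) V]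
  [LieModule ℂ (ExtWitt n) V]

/-- The representation of the Weyl algebra on an `AW_n^+` module, where `t_i` and `∂_i` act as the
elements of the same name of `W_n^+ ⋉ A_n^+`. -/
noncomputable def IsAWModule.weylRep (hAW : IsAWModule n V) : WeylAlg n →ₐ[ℂ] Module.End ℂ V :=
  WeylAlg.rep
    (fun i => LieModule.toEnd ℂ (ExtWitt n) V (polyElt (MvPolynomial.X i)))
    (fun i => wittEnd n V (MvPolynomial.pderiv i))
    (fun i j => by
      ext v
      simp only [Module.End.mul_apply, LieModule.toEnd_apply_apply, hAW.mul_lie]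
      rw [mul_comm])
    (fun i j => by
      rw [← sub_eq_zero, ← wittEnd_lie, pderiv_lie_pderiv, map_zero])
    (fun i j => by
      ext v
      simp only [Module.End.mul_apply, LieModule.toEnd_apply_apply, wittEnd_apply,
        LinearMap.add_apply]
      rw [leibniz_lie, lie_wittElt_polyElt, MvPolynomial.pderiv_X, Pi.single_apply, add_comm]
      congr 1
      by_cases hij : i = j
      · rw [if_pos hij, if_pos hij.symm, hAW.one_lie, Module.End.one_apply]
      · rw [if_neg hij, if_neg (Ne.symm hij), LinearMap.zero_apply]
        exact (congrArg (⁅·, v⁆) (map_zero (LieAlgebra.SemiDirectSum.inl (wittAction n)))).trans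
          (zero_lie v))

/-- An `AW_n^+` module, as a module over the Weyl algebra. -/
@[reducible] noncomputable def IsAWModule.weylModule (hAW : IsAWModule n V) :
    Module (WeylAlg n) V :=
  Module.compHom V hAW.weylRep.toRingHom

theorem IsAWModule.isScalarTower (hAW : IsAWModule n V) :
    letI := hAW.weylModule
    IsScalarTower ℂ (WeylAlg n) V :=
  letI := hAW.weylModule
  ⟨fun c x v => LinearMap.congr_fun (map_smul hAW.weylRep c x) v⟩

theorem IsAWModule.isWeylCompatible (hAW : IsAWModule n V) :
    letI := hAW.weylModule
    IsWeylCompatible n V := by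
  let := hAW.weylModule
  have := hAW.isScalarTower
  refine ⟨fun f v => ?_, fun i v => LinearMap.congr_fun (rep_d _ _ _ i) v⟩
  induction f using MvPolynomial.induction_on generalizing v with
  | C a =>
    have e : (MvPolynomial.C a : PolyAlg n) = a • 1 := by
      rw [← MvPolynomial.C_mul', mul_one]
    have e' : polyElt (a • 1 : PolyAlg n) = a • polyElt (1 : PolyAlg n) :=
      map_smul (LieAlgebra.SemiDirectSum.inl (wittAction n)) a 1
    rw [e, map_smul, map_one, smul_assoc, one_smul, e', smul_lie, hAW.one_lie]
  | add p q hp hq =>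
    have e : polyElt (p + q) = polyElt p + polyElt q :=
      map_add (LieAlgebra.SemiDirectSum.inl (wittAction n)) p q
    rw [map_add, add_smul, hp, hq, e, add_lie]
  | mul_X p i hp =>
    rw [map_mul, mul_smul, hp, ofPoly_X, ← hAW.mul_lie]
    congr 1
    exact LinearMap.congr_fun (rep_t _ _ _ i) v

theorem commute_weylEulerOp {P : Type*} [AddCommGroup P] [Module ℂ P] [Module (WeylAlg n) P]
    [IsScalarTower ℂ (WeylAlg n) P] (i j : Fin n) :
    Commute (weylEulerOp n P i) (weylEulerOp n P j) := by
  by_cases hij : i = j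
  · rw [hij]
  · refine Commute.map ?_ (Algebra.lsmul ℂ ℂ P : WeylAlg n →ₐ[ℂ] Module.End ℂ P)
    exact ((show Commute (t i : WeylAlg n) (t j) from t_mul_t i j).mul_left
        (commute_d_t hij)).mul_right
      ((commute_d_t (Ne.symm hij)).symm.mul_left (d_mul_d i j))

end WeylModule

section Main

set_option linter.unusedSectionVars false

variable {n : ℕ} {V : Type*} [AddCommGroup V] [Module ℂ V] [LieRingModule (ExtWitt n) V]
  [LieModule ℂ (ExtWitt n) V] [Module (WeylAlg n) V] [IsScalarTower ℂ (WeylAlg n) V]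
  (P : Type*) [AddCommGroup P] [Module ℂ P] [Module (WeylAlg n) P]
  [IsScalarTower ℂ (WeylAlg n) P]

/-- The multiplicity space of `P` in `V`, as a module over `𝔤𝔩_n`. -/
@[reducible] noncomputable def IsWeylCompatible.glModule (h : IsWeylCompatible n V) :
    LieRingModule (GL_Lie n) (P →ₗ[WeylAlg n] V) where
  bracket B f := glHom P h B f
  add_lie B C f := by
    change glHom P h (B + C) f = _
    rw [map_add]
    rfl
  lie_add B f g := map_add (glHom P h B) f g
  leibniz_lie B C f := by
    change glHom P h B (glHom P h C f) = glHom P h ⁅B, C⁆ f + glHom P h C (glHom P h B f)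
    rw [LieHom.map_lie, LieRing.of_associative_ring_bracket, LinearMap.sub_apply]
    exact (sub_add_cancel _ _).symm

theorem IsWeylCompatible.glModule_lieModule (h : IsWeylCompatible n V) :
    letI := h.glModule P
    LieModule ℂ (GL_Lie n) (P →ₗ[WeylAlg n] V) :=
  letI := h.glModule P
  { smul_lie := fun c B f => by
      change glHom P h (c • B) f = c • glHom P h B f
      rw [map_smul, LinearMap.smul_apply]
    lie_smul := fun c B f => map_smul (glHom P h B) c f }

variable {P}

/-- A `𝔤𝔩_n` submodule `M'` of the multiplicity space gives the submodule `P ⊗ M'` of `V`. -/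
theorem IsWeylCompatible.isIrreducible_glModule (h : IsWeylCompatible n V)
    (hV : LieModule.IsIrreducible ℂ (ExtWitt n) V)
    (hbij : Function.Bijective (evalTensor n P V)) [Nontrivial P]
    [Nontrivial (P →ₗ[WeylAlg n] V)]
    (hW : ∀ (D : WittPlus n) (v : V), wittEnd n V D v = (ofWitt D : WeylAlg n) • v + ∑ i, ∑ j,
      (ofPoly (MvPolynomial.pderiv i (D (MvPolynomial.X j))) : WeylAlg n) •
        glEnd h (Matrix.single i j 1) v) :
    letI := h.glModule P
    LieModule.IsIrreducible ℂ (GL_Lie n) (P →ₗ[WeylAlg n] V) := by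
  let := h.glModule P
  refine LieModule.IsIrreducible.mk fun M' hM' => ?_
  let N : Submodule ℂ V :=
    LinearMap.range (evalTensor n P V ∘ₗ LinearMap.lTensor P M'.toSubmodule.subtype)
  have hK : ∀ (x : WeylAlg n), ∀ v ∈ N, x • v ∈ N := by
    rintro x _ ⟨u, rfl⟩
    refine ⟨LinearMap.rTensor _ (Algebra.lsmul ℂ ℂ P x) u, ?_⟩
    rw [LinearMap.comp_apply, LinearMap.comp_apply, ← evalTensor_weylOp, ← LinearMap.comp_apply
      (LinearMap.lTensor P _), LinearMap.lTensor_comp_rTensor, ← LinearMap.rTensor_comp_lTensor]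
    rfl
  have hgl : ∀ (B : GL_Lie n), ∀ v ∈ N, glEnd h B v ∈ N := by
    rintro B _ ⟨u, rfl⟩
    induction u using TensorProduct.induction_on with
    | zero => rw [map_zero, map_zero]; exact N.zero_mem
    | tmul p f => exact ⟨p ⊗ₜ ⟨⁅B, (f : P →ₗ[WeylAlg n] V)⁆, M'.lie_mem f.2⟩, rfl⟩
    | add u w hu hw => rw [map_add, map_add]; exact N.add_mem hu hw
  have htop : N = ⊤ := by
    refine h.eq_top_of_invariant hV ?_ hK fun D v hv => ?_
    · obtain ⟨f, hf, hf0⟩ := Submodule.exists_mem_ne_zero_of_ne_bot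
        (mt (LieSubmodule.toSubmodule_eq_bot M').1 hM')
      obtain ⟨p, hp⟩ : ∃ p, f p ≠ 0 := by
        by_contra! h0
        exact hf0 (LinearMap.ext h0)
      exact (Submodule.ne_bot_iff _).2 ⟨f p, ⟨p ⊗ₜ ⟨f, hf⟩, rfl⟩, hp⟩
    · rw [hW]
      exact N.add_mem (hK _ _ hv)
        (N.sum_mem fun i _ => N.sum_mem fun j _ => hK _ _ (hgl _ _ hv))
  -- As `evalTensor` is injective, `P ⊗ M' → P ⊗ Hom(P, V)` is onto, and `P` is faithfully flat.
  have hsurj : Function.Surjective (LinearMap.lTensor P M'.toSubmodule.subtype) := by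
    intro u
    obtain ⟨w, hw⟩ : evalTensor n P V u ∈ N := htop ▸ Submodule.mem_top
    exact ⟨w, hbij.1 hw⟩
  have hsurj' := (Module.FaithfullyFlat.lTensor_surjective_iff_surjective ℂ P _).1 hsurj
  rw [← LieSubmodule.toSubmodule_eq_top, ← Submodule.range_subtype M'.toSubmodule]
  exact LinearMap.range_eq_top.2 hsurj'

theorem IsWeylCompatible.evalTensor_tensorRep (h : IsWeylCompatible n V)
    (hW : ∀ (D : WittPlus n) (v : V), wittEnd n V D v = (ofWitt D : WeylAlg n) • v + ∑ i, ∑ j,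
      (ofPoly (MvPolynomial.pderiv i (D (MvPolynomial.X j))) : WeylAlg n) •
        glEnd h (Matrix.single i j 1) v) (x : ExtWitt n)
    (u : P ⊗[ℂ] (P →ₗ[WeylAlg n] V)) :
    letI := h.glModule P
    letI := h.glModule_lieModule P
    evalTensor n P V (tensorRep n P (P →ₗ[WeylAlg n] V) x u) = ⁅x, evalTensor n P V u⁆ := by
  let := h.glModule P
  have := h.glModule_lieModule P
  have hweyl : ∀ (y : WeylAlg n) (u : P ⊗[ℂ] (P →ₗ[WeylAlg n] V)),
      evalTensor n P V (weylOp n P _ y u) = y • evalTensor n P V u := evalTensor_weylOp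
  have hgl : ∀ (B : GL_Lie n) (u : P ⊗[ℂ] (P →ₗ[WeylAlg n] V)),
      evalTensor n P V (glOp n P _ B u) = glEnd h B (evalTensor n P V u) := evalTensor_glHom h
  rw [lie_eq_add, ← h.ofPoly_smul, ← wittEnd_apply, hW]
  have e : tensorRep n P (P →ₗ[WeylAlg n] V) x =
      weylOp n P (P →ₗ[WeylAlg n] V) (ofPoly x.left) + wittOp n P (P →ₗ[WeylAlg n] V) x.right := rfl
  rw [e, wittOp]
  simp only [LinearMap.add_apply, LinearMap.sum_apply, Module.End.mul_apply, map_add, map_sum,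
    hweyl, hgl]

end Main

theorem theorem3p9 (n : ℕ) {V : Type u} [AddCommGroup V] [Module ℂ V]
    [LieRingModule (ExtWitt n) V] [LieModule ℂ (ExtWitt n) V]
    (hAW : IsAWModule n V) (hsimple : LieModule.IsIrreducible ℂ (ExtWitt n) V)
    (hweight : IsWeight (eulerOp n V)) (hbdd : HasBoundedWeightSpaces (eulerOp n V)) :
    ∃ (P : Type u) (_ : AddCommGroup P) (_ : Module ℂ P) (_ : Module (WeylAlg n) P)
      (_ : IsScalarTower ℂ (WeylAlg n) P)
      (M : Type u) (_ : AddCommGroup M) (_ : Module ℂ M) (_ : LieRingModule (GL_Lie n) M)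
      (_ : LieModule ℂ (GL_Lie n) M),
      IsSimpleModule (WeylAlg n) P ∧ IsWeight (weylEulerOp n P) ∧
      LieModule.IsIrreducible ℂ (GL_Lie n) M ∧ FiniteDimensional ℂ M ∧
      Nonempty (V ≃ₗ⁅ℂ, ExtWitt n⁆ TensorModule P M) := by
  let := hAW.weylModule
  have := hAW.isScalarTower
  have h := hAW.isWeylCompatible
  have : SMulCommClass ℂ (WeylAlg n) V := IsScalarTower.to_smulCommClass
  obtain ⟨α, hα⟩ : ∃ α, weightSpace (eulerOp n V) α ≠ ⊥ := by
    by_contra! hbot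
    have : Nontrivial (LieSubmodule ℂ (ExtWitt n) V) := hsimple.toNontrivial
    have hV := (LieSubmodule.nontrivial_iff ℂ (ExtWitt n) V).1 this
    have htop := hweight.2
    rw [iSup_eq_bot.2 hbot] at htop
    exact bot_ne_top htop
  have hfin : FiniteDimensional ℂ (weightSpace (eulerOp n V) α) := by
    obtain ⟨N, hN⟩ := hbdd
    exact Module.rank_lt_aleph0_iff.1 ((hN α).trans_lt (Cardinal.natCast_lt_aleph0))
  have hcomm := commute_weylEulerOp (n := n) (P := V)
  -- A weight space of `V` is invariant under the operators `t_i ∂_i` of the Weyl algebra.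
  obtain ⟨v₁, hv₁, β, hβ⟩ := exists_ne_zero_mem_weightSpace hcomm _ hα (fun i w hw j => by
    have e : Commute (eulerOp n V j) (weylEulerOp n V i) := by
      rw [eulerOp_eq h j]
      exact (hcomm j i).add_left (commute_glEnd h _ _)
    rw [← Module.End.mul_apply, e.eq, Module.End.mul_apply, hw j, map_smul])
  obtain ⟨v, hv0, lam, hv⟩ := exists_isVacuum hv₁ hβ
  obtain ⟨w, hw, hw0⟩ := Submodule.exists_mem_ne_zero_of_ne_bot hα
  let P : Submodule (WeylAlg n) V := Submodule.span (WeylAlg n) {v}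
  let p₀ : P := ⟨v, Submodule.mem_span_singleton_self v⟩
  have hp₀0 : p₀ ≠ 0 := fun h0 => hv0 (congrArg Subtype.val h0)
  have hp₀ : ∀ i, IsVacuum (t i : WeylAlg n) (d i) (lam i) p₀ := fun i =>
    ⟨Subtype.ext (hv i).1, (hv i).2.imp (fun h' => ⟨Subtype.ext h'.1, h'.2⟩)
      (Or.imp (fun h' => ⟨Subtype.ext h'.1, h'.2⟩) id)⟩
  have htop : Submodule.span (WeylAlg n) {p₀} = ⊤ := by
    rw [eq_top_iff]
    rintro ⟨x, hx⟩ -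
    obtain ⟨y, rfl⟩ := Submodule.mem_span_singleton.1 hx
    exact Submodule.mem_span_singleton.2 ⟨y, rfl⟩
  have hι : P.subtype ≠ 0 := fun h0 => hv0 (LinearMap.congr_fun h0 p₀)
  have hsurj := h.evalTensor_surjective hsimple hι
  have hbij : Function.Bijective (evalTensor n P V) := ⟨evalTensor_injective hp₀ htop, hsurj⟩
  have : Nontrivial P := ⟨⟨p₀, 0, hp₀0⟩⟩
  have : Nontrivial (P →ₗ[WeylAlg n] V) := ⟨⟨P.subtype, 0, hι⟩⟩
  have hfd := finiteDimensional_hom h hsimple hp₀ hp₀0 htop hsurj hweight hbdd hw0 hw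
  have hW := h.wittEnd_apply_eq hsimple hbij
  let := h.glModule P
  have := h.glModule_lieModule P
  let e : TensorModule P (P →ₗ[WeylAlg n] V) ≃ₗ⁅ℂ, ExtWitt n⁆ V :=
    { LinearEquiv.ofBijective (evalTensor n P V) hbij with
      map_lie' := fun {x u} => h.evalTensor_tensorRep hW x u }
  exact ⟨P, inferInstance, inferInstance, inferInstance, inferInstance, P →ₗ[WeylAlg n] V,
    inferInstance, inferInstance, inferInstance, inferInstance, isSimpleModule_span hv hv0,
    isWeight_of_span_eq_top hp₀ htop, h.isIrreducible_glModule hsimple hbij hW, hfd, ⟨e.symm⟩⟩
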